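/- Notation. Inequalities between vectors of $\mathbb{R}^2$, and absolute values and logarithms of vectors, are componentwise. Let $\mathbb{T}^2=\{z\in\mathbb{C}^2:|z_1|=|z_2|=1\}$ and let $m$ be its normalised Lebesgue measure. For $\ell\in\{1,-1\}$ let $\Sigma^\ell=\{\sigma\in\{\pm1\}^2:\sigma_1\sigma_2=\ell\}$. For $P\in\mathrm{GL}_2(\mathbb{R})$, $\delta\in\mathbb{R}^2$ and $\sigma\in\{\pm1\}^2$ put $$\Lambda^\sigma_{P,\delta}=P\{y\in\mathbb{R}^2:\sigma_1y_1>\delta_1,\ \sigma_2y_2>\delta_2\},\qquad D^\sigma_{P,\delta}=\{z\in(\mathbb{C}\setminus\{0\})^2:\log|z|\in\Lambda^\sigma_{P,\delta}\},$$ $$\mathbb{T}^\sigma_{P,\delta}=\{z\in\mathbb{C}^2: |z|=e^{v}\},\quad v=P(\sigma_1\delta_1,\sigma_2\delta_2)^T,\qquad \mathcal{A}_{P,\delta}=\{z\in(\mathbb{C}\setminus\{0\})^2:-|\delta|<P^{-1}\log|z|<|\delta|\}.$$ For $\rho\in\mathbb{R}^2_{>0}$ let $\mathbb{T}^2_\rho=\{z\in\mathbb{C}^2:|z|=\rho\}$.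 For $\delta,\Delta\in\mathbb{R}^2_{>0}$, a map that is holomorphic, with values in $\mathbb{C}^2$, on a neighbourhood of $\overline{\mathcal{A}_{P,\delta}}$ is called $(\ell,\delta,\Delta,P)$-strongly expanding if either (EP) it maps $\mathbb{T}^\sigma_{P,\delta}$ into $D^\sigma_{P,\Delta}$ and $\overline{\Lambda^\sigma_{P,\Delta}}\subset\Lambda^\sigma_{P,\delta}$ for all $\sigma\in\Sigma^\ell$, or (ER) it maps $\mathbb{T}^\sigma_{P,\delta}$ into $D^{-\sigma}_{P,\Delta}$ and $\overline{\Lambda^{-\sigma}_{P,\Delta}}\subset\Lambda^{-\sigma}_{P,\delta}$ for all $\sigma\in\Sigma^\ell$. For $\alpha,\beta\in\mathbb{R}^2$ let $H_{P,\alpha,\beta}$ be the Hilbert space completion of the space of Laurent polynomials $f=\sum_{n\in\mathbb{Z}^2} f_nz^n$ with respect to the norm $\|f\|_\nu=(\sum_n|f_n|^2\nu(n)^2)^{1/2}$, where $\nu(n)=\exp(-a_1|k_1|-a_2|k_2|)$ with $k=P^Tn$, and $a=\alpha$ if $k_1k_2\ge0$, $a=\beta$ if $k_1k_2<0$. A function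 $g$ on $\mathbb{T}^2$ is identified with $h\in H_{P,\alpha,\beta}$ if its Fourier series $\sum_n\hat g(n)z^n$, $\hat g(n)=\int_{\mathbb{T}^2} g(z)z^{-n}\,dm(z)$, converges (unconditionally) to $h$ in $H_{P,\alpha,\beta}$. Theorem. Let $T$ be an analytic diffeomorphism of $\mathbb{T}^2$. Assume that there are $\alpha,\gamma,A,\Gamma,\eta\in\mathbb{R}^2_{>0}$ with $\alpha,\gamma<\eta$, and $P\in\mathrm{GL}_2(\mathbb{R})$, such that $T$ and $T^{-1}$ extend to holomorphic maps $\mathcal{A}_{P,\eta}\to\mathbb{C}^2$ (again denoted by $T$ and $T^{-1}$), and such that (i) $T$ is $(1,\alpha,A,P)$-strongly expanding; (ii) $T^{-1}$ is $(-1,\Gamma,\gamma,P)$-strongly expanding; (iii) for all $\tilde\sigma\in\Sigma^1$ and $\sigma\in\Sigma^{-1}$ there is $\rho\in\mathbb{R}^2_{>0}$ with $\mathbb{T}^2_\rho\subset D^\sigma_{P,\gamma}\cap\mathcal{A}_{P,\eta}$ and $T(\mathbb{T}^2_\rho)\subset D^{\tilde\sigma}_{P,A}$. Then the composition operator $C_T\colon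 f\mapsto f\circ T$ maps $H_{P,A,-\Gamma}$ continuously to $H_{P,\alpha,-\gamma}$: there is exactly one continuous linear operator $H_{P,A,-\Gamma}\to H_{P,\alpha,-\gamma}$ that sends every Laurent polynomial $f$ to $f\circ T$. -/

import Mathlib

open scoped ComplexConjugate

noncomputable section

namespace TorusHardy

/-! ### Quadrants, cones, Reinhardt domains and annuli -/

/-- The two sign vectors `σ = (σ₁, σ₂) ∈ {±1}²` with `σ₁ σ₂ = ℓ`, where `ℓ = 1` or `ℓ = -1`. -/
def signs (l : ℤˣ) : Set (Fin 2 → ℤˣ) := {σ | σ 0 * σ 1 = l}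

/-- The sign `±1` as a real number. -/
def sgn (s : ℤˣ) : ℝ := ((s : ℤ) : ℝ)

/-- The affine cone `Λ = P (I^σ (ℝ²_{>0} + δ))`: the image under `P` of the translated quadrant
`{y | σ₁ y₁ > δ₁, σ₂ y₂ > δ₂}`. -/
def cone (P : Matrix.GeneralLinearGroup (Fin 2) ℝ) (δ : Fin 2 → ℝ) (σ : Fin 2 → ℤˣ) :
    Set (Fin 2 → ℝ) :=
  (fun y => P.1.mulVec y) '' {y | ∀ i, δ i < sgn (σ i) * y i}

/-- The apex `v = P (I^σ δ)` of that cone. -/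
def apex (P : Matrix.GeneralLinearGroup (Fin 2) ℝ) (δ : Fin 2 → ℝ) (σ : Fin 2 → ℤˣ) :
    Fin 2 → ℝ :=
  P.1.mulVec fun i => sgn (σ i) * δ i

/-- `log |z| = (log |z₁|, log |z₂|)`; only used for `z` with nonzero coordinates. -/
def logAbs (z : Fin 2 → ℂ) : Fin 2 → ℝ := fun i => Real.log ‖z i‖

/-- The log-conical Reinhardt domain with logarithmic base `cone P δ σ`, as a subset of
`(ℂ \ {0})²`. -/
def domain (P : Matrix.GeneralLinearGroup (Fin 2) ℝ) (δ : Fin 2 → ℝ) (σ : Fin 2 → ℤˣ) :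
    Set (Fin 2 → ℂ) :=
  {z | (∀ i, z i ≠ 0) ∧ logAbs z ∈ cone P δ σ}

/-- The torus `{z ∈ ℂ² | |z₁| = ρ₁, |z₂| = ρ₂}`. -/
def polyTorus (ρ : Fin 2 → ℝ) : Set (Fin 2 → ℂ) := {z | ∀ i, ‖z i‖ = ρ i}

/-- The distinguished boundary of `domain P δ σ`. -/
def shilovTorus (P : Matrix.GeneralLinearGroup (Fin 2) ℝ) (δ : Fin 2 → ℝ) (σ : Fin 2 → ℤˣ) :
    Set (Fin 2 → ℂ) :=
  polyTorus fun i => Real.exp (apex P δ σ i)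

/-- The annulus `{z | -|δ| < P⁻¹ log |z| < |δ|}`, a neighbourhood of the unit torus. -/
def annulus (P : Matrix.GeneralLinearGroup (Fin 2) ℝ) (δ : Fin 2 → ℝ) : Set (Fin 2 → ℂ) :=
  {z | (∀ i, z i ≠ 0) ∧ ∀ i, |(P⁻¹).1.mulVec (logAbs z) i| < |δ i|}

/-! ### Maps of the torus -/

/-- A point of the unit torus `𝕋²` as a point of `ℂ²`. -/
def toC2 (z : Fin 2 → Circle) : Fin 2 → ℂ := fun i => (z i : ℂ)

/-- `F` is a holomorphic extension to `U` of the self-map `T` of the unit torus. -/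
def IsHolomorphicExtension (T : (Fin 2 → Circle) → (Fin 2 → Circle))
    (F : (Fin 2 → ℂ) → (Fin 2 → ℂ)) (U : Set (Fin 2 → ℂ)) : Prop :=
  DifferentiableOn ℂ F U ∧ ∀ z, F (toC2 z) = toC2 (T z)

/-- The `(ℓ, δ, Δ, P)`-strongly expanding mapping property of a map `F` which is holomorphic near
the closure of the annulus of width `δ`: the distinguished boundaries of width `δ` are mapped into
the domains of width `Δ` with the same sign vector (first alternative), or with the opposite sign
vector (second alternative), and the latter domains are relatively compact in those of width `δ`.
Relative compactness of log-conical domains is expressed through their logarithmic bases. -/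
def StronglyExpanding (l : ℤˣ) (δ Δ : Fin 2 → ℝ) (P : Matrix.GeneralLinearGroup (Fin 2) ℝ)
    (F : (Fin 2 → ℂ) → (Fin 2 → ℂ)) : Prop :=
  (∃ U : Set (Fin 2 → ℂ), IsOpen U ∧ closure (annulus P δ) ⊆ U ∧ DifferentiableOn ℂ F U) ∧
  ((∀ σ ∈ signs l, Set.MapsTo F (shilovTorus P δ σ) (domain P Δ σ) ∧
      closure (cone P Δ σ) ⊆ cone P δ σ) ∨
   (∀ σ ∈ signs l, Set.MapsTo F (shilovTorus P δ σ) (domain P Δ (-σ)) ∧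
      closure (cone P Δ (-σ)) ⊆ cone P δ (-σ)))

/-! ### Laurent polynomials with a weighted norm, and their completion -/

/-- Laurent polynomials `∑ fₙ zⁿ`, `n ∈ ℤ²`, given by their coefficients. The parameter `ν` is the
weight of the norm that this space carries. -/
def Laurent (_ν : (Fin 2 → ℤ) → {x : ℝ // 0 < x}) : Type := (Fin 2 → ℤ) →₀ ℂ

variable (ν : (Fin 2 → ℤ) → {x : ℝ // 0 < x})

instance : AddCommGroup (Laurent ν) := inferInstanceAs (AddCommGroup ((Fin 2 → ℤ) →₀ ℂ))

instance : Module ℂ (Laurent ν) := inferInstanceAs (Module ℂ ((Fin 2 → ℤ) →₀ ℂ))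

/-- The coefficient of `zⁿ`. -/
def Laurent.coeff {ν : (Fin 2 → ℤ) → {x : ℝ // 0 < x}} (f : Laurent ν) (n : Fin 2 → ℤ) : ℂ :=
  (show (Fin 2 → ℤ) →₀ ℂ from f) n

theorem Laurent.finite_support {ν : (Fin 2 → ℤ) → {x : ℝ // 0 < x}} (f : Laurent ν) :
    (Function.support f.coeff).Finite :=
  Finsupp.hasFiniteSupport (show (Fin 2 → ℤ) →₀ ℂ from f)

/-- The weighted inner product `∑ₙ conj(fₙ) gₙ ν(n)²` (conjugate linear in the first argument). -/
def weightedInner (f g : Laurent ν) : ℂ :=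
  ∑ᶠ n, conj (f.coeff n) * g.coeff n * ((((ν n : ℝ) ^ 2 : ℝ)) : ℂ)

theorem weightedInner_eq_sum (f g : Laurent ν) (s : Finset (Fin 2 → ℤ))
    (hs : Function.support f.coeff ⊆ s) :
    weightedInner ν f g =
      ∑ n ∈ s, conj (f.coeff n) * g.coeff n * ((((ν n : ℝ) ^ 2 : ℝ)) : ℂ) := by
  refine finsum_eq_sum_of_support_subset _ fun n hn => hs ?_
  simp only [Function.mem_support] at hn ⊢
  intro h
  exact hn (by simp [h])

theorem weightedInner_self (f : Laurent ν) :
    weightedInner ν f f =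
      ((∑ n ∈ f.finite_support.toFinset, ‖f.coeff n‖ ^ 2 * (ν n : ℝ) ^ 2 : ℝ) : ℂ) := by
  rw [weightedInner_eq_sum ν f f f.finite_support.toFinset (by simp)]
  push_cast
  refine Finset.sum_congr rfl fun n _ => ?_
  rw [Complex.conj_mul']

/-- The weighted inner product is an inner product. -/
@[reducible]
def laurentCore : InnerProductSpace.Core ℂ (Laurent ν) where
  inner := weightedInner ν
  conj_inner_symm f g := by
    classical
    rw [weightedInner_eq_sum ν f g (f.finite_support.toFinset ∪ g.finite_support.toFinset)
        (by simp),
      weightedInner_eq_sum ν g f (f.finite_support.toFinset ∪ g.finite_support.toFinset)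
        (by simp), map_sum]
    refine Finset.sum_congr rfl fun n _ => ?_
    rw [map_mul, map_mul, Complex.conj_conj, Complex.conj_ofReal]
    ring
  re_inner_nonneg f := by
    rw [weightedInner_self]
    exact Finset.sum_nonneg fun n _ => by positivity
  add_left f g h := by
    classical
    let s := f.finite_support.toFinset ∪ g.finite_support.toFinset
    have hc : ∀ n, (f + g).coeff n = f.coeff n + g.coeff n := fun n => rfl
    rw [weightedInner_eq_sum ν (f + g) h s, weightedInner_eq_sum ν f h s (by simp [s]),
      weightedInner_eq_sum ν g h s (by simp [s]), ← Finset.sum_add_distrib]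
    · refine Finset.sum_congr rfl fun n _ => ?_
      rw [hc, map_add]
      ring
    · intro n hn
      by_contra hns
      simp only [s, Finset.coe_union, Set.Finite.coe_toFinset, Set.mem_union,
        Function.mem_support, not_or, not_not] at hns
      exact hn (by rw [hc, hns.1, hns.2, add_zero])
  smul_left f g r := by
    have hc : ∀ n, (r • f).coeff n = r * f.coeff n := fun n => rfl
    rw [weightedInner_eq_sum ν (r • f) g f.finite_support.toFinset,
      weightedInner_eq_sum ν f g f.finite_support.toFinset (by simp), Finset.mul_sum]
    · refine Finset.sum_congr rfl fun n _ => ?_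
      rw [hc, map_mul]
      ring
    · intro n hn
      simp only [Set.Finite.coe_toFinset, Function.mem_support]
      intro h
      exact hn (by rw [hc, h, mul_zero])
  definite f hf := by
    rw [weightedInner_self, Complex.ofReal_eq_zero,
      Finset.sum_eq_zero_iff_of_nonneg fun n _ => by positivity] at hf
    refine Finsupp.ext fun n => ?_
    by_contra hn
    have hn' : f.coeff n ≠ 0 := hn
    have h := hf n (by simpa using hn')
    have hν := (ν n).2
    have hp : 0 < ‖f.coeff n‖ := norm_pos_iff.mpr hn'
    exact (mul_pos (pow_pos hp 2) (pow_pos hν 2)).ne' h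

instance : NormedAddCommGroup (Laurent ν) := (laurentCore ν).toNormedAddCommGroup

instance : InnerProductSpace ℂ (Laurent ν) := InnerProductSpace.ofCore (laurentCore ν).toCore

/-- The Hilbert space `H_ν`: the completion of the Laurent polynomials in the norm `‖·‖_ν`. -/
abbrev HardySpace : Type := UniformSpace.Completion (Laurent ν)

/-- The monomial `zⁿ` as a Laurent polynomial. -/
def monomial (n : Fin 2 → ℤ) : Laurent ν :=
  show (Fin 2 → ℤ) →₀ ℂ from Finsupp.single n 1

/-- The function on the unit torus `z ↦ ∑ fₙ zⁿ` given by a Laurent polynomial. -/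
def Laurent.toFun {ν : (Fin 2 → ℤ) → {x : ℝ // 0 < x}} (f : Laurent ν) (z : Fin 2 → Circle) : ℂ :=
  ∑ᶠ n : Fin 2 → ℤ, f.coeff n * ∏ i, (z i : ℂ) ^ n i

/-- The `n`-th Fourier coefficient `∫ g(z) z⁻ⁿ dm(z)` of a function `g` on the unit torus, where
`m` is the normalised Lebesgue measure. -/
def fourierCoefficient (g : (Fin 2 → Circle) → ℂ) (n : Fin 2 → ℤ) : ℂ :=
  UnitAddTorus.mFourierCoeff (fun x : UnitAddTorus (Fin 2) => g fun i => (x i).toCircle) n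

/-- `Represents g h`: the element `h` of `H_ν` is the function `g` on the unit torus, that is, the
Fourier series of `g` converges to `h` in `H_ν`. -/
def Represents {ν : (Fin 2 → ℤ) → {x : ℝ // 0 < x}} (g : (Fin 2 → Circle) → ℂ)
    (h : HardySpace ν) : Prop :=
  HasSum (fun n => fourierCoefficient g n • ((monomial ν n : Laurent ν) : HardySpace ν)) h

/-- The cone-wise exponential weight `ν(n) = exp(-⟨a(m), |m|⟩)` with `m = Pᵀ n`, where `a(m) = α`
if `m₁ m₂ ≥ 0` and `a(m) = β` if `m₁ m₂ < 0`. -/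
def coneWeight (P : Matrix.GeneralLinearGroup (Fin 2) ℝ) (α β : Fin 2 → ℝ) (n : Fin 2 → ℤ) :
    {x : ℝ // 0 < x} :=
  let m : Fin 2 → ℝ := P.1.transpose.mulVec fun i => (n i : ℝ)
  ⟨Real.exp (-∑ i, (if 0 ≤ m 0 * m 1 then α i else β i) * |m i|), Real.exp_pos _⟩

end TorusHardy

end

/-! In terms of monomials, `f ↦ f ∘ T` is the infinite matrix whose entry `(m, n)` is the `n`-th
Fourier coefficient of `T ^ m` (`compMatrix`). The theorem follows once this matrix is bounded
between the weighted `ℓ²` spaces. Both index sets are split by the sign of `k₁ k₂`, `k = Pᵀ n`,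
which gives four blocks.

The basic estimate is `blockBound_of_mapsTo`. Let the extension `F` send the torus `|z| = exp v`
into the domain with signs `τ` and width `A`. On compact subsets of that domain the monomials with
exponents in the quadrant `-τ` are smaller than the weight `exp (-⟨A, |k|⟩)` by a summable factor,
so Cauchy-Schwarz bounds a polynomial `f` there by its weighted norm (`exists_eval_bound`). Hence `f
∘ F` is bounded on the torus, and Bessel's inequality bounds its Laurent coefficients with weight
`exp (n ⬝ v)`. These are the Fourier coefficients of `f ∘ T` times `exp (n ⬝ v)`, because the tori
`|z| = exp (t v)` in between lie in the region of holomorphy (`mFourierCoeff_spread_one`). Negative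
powers of `F` do no harm: its components are unimodular on the unit torus, so reflection excludes
zeros on all these tori (`ne_zero_of_norm_eq_one`).

Three blocks are instances of this estimate, on the tori of (i), on those of (iii) and on the unit
torus. For the block with `k₁ k₂ < 0` on both sides one dualises: the change of variables by `T⁻¹`
turns the transposed matrix into that of composition with `T⁻¹`, multiplied by a unimodular constant
times the determinant of the Jacobian in logarithmic coordinates (`integral_torus_comp_eq`). This
factor is holomorphic and bounded on the tori of (ii), so the basic estimate applies again. -/

noncomputable section

namespace TorusHardy

open scoped ComplexConjugate Topology
open MeasureTheory Set Filter Metric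

/-! ### Holomorphy of parametric integrals and of derivatives in several variables -/

section ParametricIntegral

variable {E G α : Type*} [NormedAddCommGroup E] [NormedSpace ℂ E] [FiniteDimensional ℂ E]
  [NormedAddCommGroup G] [NormedSpace ℂ G]

/-- The Fréchet derivatives at a point of a jointly continuous family of holomorphic functions
depend continuously on the parameter. -/
theorem continuousOn_fderiv_param [TopologicalSpace α] {U : Set E} (hU : IsOpen U) {K : Set α}
    {h : E → α → G} (hc : ContinuousOn (Function.uncurry h) (U ×ˢ K))
    (hd : ∀ k ∈ K, DifferentiableOn ℂ (fun x => h x k) U) {x : E} (hx : x ∈ U) :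
    ContinuousOn (fun k => fderiv ℂ (fun x => h x k) x) K := by
  have : ProperSpace E := FiniteDimensional.proper ℂ E
  obtain ⟨r, hr, hrU⟩ := Metric.nhds_basis_closedBall.mem_iff.1 (hU.mem_nhds hx)
  intro k₀ hk₀
  refine Metric.tendsto_nhds.2 fun ε hε => ?_
  -- On a compact ball `h · k` is uniformly within `r ε / 4` of `h · k₀`. The difference then varies
  -- by at most `r ε / 2` from its value at the centre, and the Cauchy estimate on radius `r` gives
  -- `ε / 2`.
  have hδ : 0 < r * ε / 4 := by positivity
  have hev : ∀ᶠ k in 𝓝 k₀, ∀ y ∈ closedBall x r, k ∈ K → dist (h y k) (h y k₀) < r * ε / 4 := by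
    refine (isCompact_closedBall x r).eventually_forall_of_forall_eventually
      (P := fun k y => k ∈ K → dist (h y k) (h y k₀) < r * ε / 4) fun y hy => ?_
    have h1 := Metric.tendsto_nhds.1 (hc (y, k₀) ⟨hrU hy, hk₀⟩) _ (half_pos hδ)
    rw [eventually_nhdsWithin_iff] at h1
    have h2 : ∀ᶠ z : α × E in 𝓝 (k₀, y), z.2 ∈ U :=
      (continuous_snd.tendsto _).eventually (hU.mem_nhds (hrU hy))
    have h3 : ∀ᶠ z : α × E in 𝓝 (k₀, y), (z.2, z.1) ∈ U ×ˢ K →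
        dist (Function.uncurry h (z.2, z.1)) (Function.uncurry h (y, k₀)) < r * ε / 4 / 2 :=
      (continuous_swap.tendsto (k₀, y)).eventually h1
    have h4 : ∀ᶠ z : α × E in 𝓝 (k₀, y), (z.2, k₀) ∈ U ×ˢ K →
        dist (Function.uncurry h (z.2, k₀)) (Function.uncurry h (y, k₀)) < r * ε / 4 / 2 :=
      (Continuous.tendsto (f := fun z : α × E => (z.2, k₀)) (by fun_prop) (k₀, y)).eventually h1
    filter_upwards [h2, h3, h4] with z hz2 hz3 hz4 hzK
    have h5 := hz3 ⟨hz2, hzK⟩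
    have h6 := hz4 ⟨hz2, hk₀⟩
    simp only [Function.uncurry] at h5 h6
    linarith [dist_triangle_right (h z.2 z.1) (h z.2 k₀) (h y k₀)]
  filter_upwards [hev.filter_mono nhdsWithin_le_nhds, self_mem_nhdsWithin] with k hk hkK
  have hb : ∀ y ∈ closedBall x r, ‖h y k - h y k₀‖ < r * ε / 4 := fun y hy => by
    rw [← dist_eq_norm]; exact hk y hy hkK
  have hdk : DifferentiableAt ℂ (fun x => h x k) x := (hd k hkK).differentiableAt (hU.mem_nhds hx)
  have hdk₀ : DifferentiableAt ℂ (fun x => h x k₀) x :=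
    (hd k₀ hk₀).differentiableAt (hU.mem_nhds hx)
  rw [dist_eq_norm, ← fderiv_fun_sub hdk hdk₀]
  calc ‖fderiv ℂ (fun y => h y k - h y k₀) x‖ ≤ (r * ε / 2) / r := by
        refine Complex.norm_fderiv_le_div_of_mapsTo_ball
          (((hd k hkK).sub (hd k₀ hk₀)).mono (ball_subset_closedBall.trans hrU)) ?_ hr
        intro y hy
        rw [mem_closedBall, dist_eq_norm]
        have h1 := hb y (ball_subset_closedBall hy)
        have h2 := hb x (mem_closedBall_self hr.le)
        linarith [norm_sub_le (h y k - h y k₀) (h x k - h x k₀)]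
    _ < ε := by rw [div_lt_iff₀ hr]; nlinarith

/-- An integral over a compact set of a jointly continuous family of holomorphic functions is
holomorphic. -/
theorem differentiableOn_setIntegral_param [NormedSpace ℝ G] [CompleteSpace G]
    [TopologicalSpace α] [SecondCountableTopology α] [T2Space α]
    [MeasurableSpace α] [OpensMeasurableSpace α] (μ : Measure α) [IsFiniteMeasureOnCompacts μ]
    {U : Set E} (hU : IsOpen U) {K : Set α} (hK : IsCompact K)
    {h : E → α → G} (hc : ContinuousOn (Function.uncurry h) (U ×ˢ K))
    (hd : ∀ k ∈ K, DifferentiableOn ℂ (fun x => h x k) U) :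
    DifferentiableOn ℂ (fun x => ∫ k in K, h x k ∂μ) U := by
  have : ProperSpace E := FiniteDimensional.proper ℂ E
  intro x hx
  obtain ⟨r, hr, hrU⟩ := Metric.nhds_basis_closedBall.mem_iff.1 (hU.mem_nhds hx)
  obtain ⟨M, hM⟩ := ((isCompact_closedBall x r).prod hK).exists_bound_of_continuousOn
    (hc.mono (prod_mono_left hrU))
  have hcx : ∀ y ∈ U, ContinuousOn (h y) K := fun y hy =>
    hc.comp (f := fun k => (y, k)) (by fun_prop) fun k hk => ⟨hy, hk⟩
  have hcK : MeasurableSet K := hK.measurableSet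
  -- The values differ from the one at the centre by at most `2 M`, so the Schwarz lemma gives the
  -- Lipschitz bound `2 M / r` at `x`, uniformly in `k`.
  refine (hasFDerivAt_integral_of_dominated_loc_of_lip' (𝕜 := ℂ) (μ := μ.restrict K)
    (F := h) (F' := fun k => fderiv ℂ (fun x => h x k) x) (s := ball x r)
    (bound := fun _ => 2 * M / r) (ball_mem_nhds x hr) (fun y hy => ?_) ?_ ?_ ?_ ?_ ?_).2
    |>.differentiableAt.differentiableWithinAt
  · exact (hcx y (hrU (ball_subset_closedBall hy))).aestronglyMeasurable hcK
  · exact (hcx x hx).integrableOn_compact hK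
  · exact (continuousOn_fderiv_param hU hc hd hx).aestronglyMeasurable hcK
  · refine (ae_restrict_iff' hcK).2 (Eventually.of_forall fun k hk y hy => ?_)
    rw [← dist_eq_norm, ← dist_eq_norm]
    refine Complex.dist_le_div_mul_dist_of_mapsTo_ball (f := fun x => h x k)
      ((hd k hk).mono (ball_subset_closedBall.trans hrU)) ?_ hy
    intro z hz
    rw [mem_closedBall, dist_eq_norm]
    have h1 := hM (z, k) ⟨ball_subset_closedBall hz, hk⟩
    have h2 := hM (x, k) ⟨mem_closedBall_self hr.le, hk⟩
    simp only [Function.uncurry] at h1 h2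
    linarith [norm_sub_le (h z k) (h x k)]
  · exact integrableOn_const hK.measure_lt_top.ne
  · refine (ae_restrict_iff' hcK).2 (Eventually.of_forall fun k hk => ?_)
    exact ((hd k hk).differentiableAt (hU.mem_nhds hx)).hasFDerivAt

/-- Directional derivatives of a holomorphic function of several variables are holomorphic. -/
theorem differentiableOn_fderiv_apply {U : Set E} (hU : IsOpen U) {f : E → ℂ}
    (hf : DifferentiableOn ℂ f U) (e : E) :
    DifferentiableOn ℂ (fun x => fderiv ℂ f x e) U := by
  have : ProperSpace E := FiniteDimensional.proper ℂ E
  intro x hx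
  obtain ⟨r, hr, hrU⟩ := Metric.nhds_basis_closedBall.mem_iff.1 (hU.mem_nhds hx)
  obtain ⟨R, hR, hRe⟩ : ∃ R : ℝ, 0 < R ∧ R * ‖e‖ ≤ r / 2 := by
    refine ⟨r / 2 / (‖e‖ + 1), by positivity, ?_⟩
    rw [div_mul_eq_mul_div, div_le_iff₀ (by positivity)]
    nlinarith [norm_nonneg e]
  have hmem : ∀ y ∈ ball x (r / 2), ∀ ζ ∈ closedBall (0 : ℂ) R, y + ζ • e ∈ U := by
    intro y hy ζ hζ
    refine hrU ?_
    rw [mem_closedBall, dist_eq_norm]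
    rw [mem_ball, dist_eq_norm] at hy
    rw [mem_closedBall, dist_zero_right] at hζ
    calc ‖y + ζ • e - x‖ = ‖(y - x) + ζ • e‖ := by congr 1; abel
      _ ≤ ‖y - x‖ + ‖ζ‖ * ‖e‖ := (norm_add_le _ _).trans_eq (by rw [norm_smul])
      _ ≤ r / 2 + R * ‖e‖ := by gcongr
      _ ≤ r := by linarith
  -- Cauchy's formula for the derivative of `ζ ↦ f (y + ζ • e)` at `0` writes the directional
  -- derivative as an integral depending on the parameter `y`.
  let h : E → ℝ → ℂ := fun y t =>
    deriv (circleMap 0 R) t * (((circleMap 0 R t) ^ 2)⁻¹ * f (y + circleMap 0 R t • e))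
  have hcm : ∀ t, circleMap 0 R t ∈ closedBall (0 : ℂ) R := fun t =>
    sphere_subset_closedBall (circleMap_mem_sphere 0 hR.le t)
  have hne : ∀ t, circleMap 0 R t ^ 2 ≠ 0 := fun t => by simp [hR.ne']
  have key : DifferentiableOn ℂ (fun y => ∫ t in Icc 0 (2 * Real.pi), h y t)
      (ball x (r / 2)) := by
    refine differentiableOn_setIntegral_param volume isOpen_ball isCompact_Icc ?_ ?_
    · refine ContinuousOn.mul ?_ (ContinuousOn.mul ?_ ?_)
      · simp only [deriv_circleMap]
        fun_prop
      · exact ContinuousOn.inv₀ (by fun_prop) fun p _ => hne p.2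
      · refine hf.continuousOn.comp (by fun_prop) fun p hp => hmem p.1 hp.1 _ (hcm p.2)
    · intro t _
      refine DifferentiableOn.const_mul (DifferentiableOn.const_mul ?_ _) _
      exact hf.comp (by fun_prop) fun y hy => hmem y hy _ (hcm t)
  have heq : ∀ y ∈ ball x (r / 2), fderiv ℂ f y e =
      (2 * Real.pi * Complex.I : ℂ)⁻¹ * ∫ t in Icc 0 (2 * Real.pi), h y t := by
    intro y hy
    have hyU : y ∈ U := by simpa using hmem y hy 0 (mem_closedBall_self hR.le)
    have hmaps : MapsTo (fun ζ : ℂ => y + ζ • e) (closedBall 0 R) U := fun ζ hζ => hmem y hy ζ hζ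
    have h1 : HasDerivAt (fun ζ : ℂ => f (y + ζ • e)) (fderiv ℂ f y e) 0 := by
      have h2 : HasDerivAt (fun ζ : ℂ => y + ζ • e) e 0 := by
        simpa using ((hasDerivAt_id (0 : ℂ)).smul_const e).const_add y
      have h3 : HasFDerivAt f (fderiv ℂ f y) (y + (0 : ℂ) • e) := by
        simpa using (hf.differentiableAt (hU.mem_nhds hyU)).hasFDerivAt
      exact h3.comp_hasDerivAt 0 h2
    have h4 : DifferentiableOn ℂ (fun ζ : ℂ => f (y + ζ • e)) (closedBall 0 R) :=
      hf.comp (by fun_prop) hmaps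
    have h5 := DifferentiableOn.deriv_eq_smul_circleIntegral hR h4
    rw [← h1.deriv, eq_inv_mul_iff_mul_eq₀ Complex.two_pi_I_ne_zero, ← smul_eq_mul, ← h5,
      circleIntegral, intervalIntegral.integral_of_le Real.two_pi_pos.le,
      integral_Icc_eq_integral_Ioc]
    simp [h]
  have h6 := (key.const_mul (2 * Real.pi * Complex.I : ℂ)⁻¹).congr heq
  exact (h6.differentiableAt (ball_mem_nhds x (half_pos hr))).differentiableWithinAt

end ParametricIntegral

/-- The measure on `ℝ / ℤ` is the normalised Haar measure. -/
local instance : MeasureSpace UnitAddCircle := ⟨AddCircle.haarAddCircle⟩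

local instance : Measure.IsAddHaarMeasure (volume : Measure UnitAddCircle) :=
  inferInstanceAs (Measure.IsAddHaarMeasure AddCircle.haarAddCircle)

local instance : IsProbabilityMeasure (volume : Measure UnitAddCircle) :=
  inferInstanceAs (IsProbabilityMeasure AddCircle.haarAddCircle)

/-! ### Families of tori, reflection and Laurent coefficients -/

section Spread

/-- The closed strip `|Re s| ≤ 1`. -/
def strip : Set ℂ := {s | s.re ∈ Icc (-1) 1}

theorem isPreconnected_strip : IsPreconnected strip :=
  ((convex_Icc (-1 : ℝ) 1).is_linear_preimage Complex.reLm.isLinear).isPreconnected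

/-- Identity theorem: the imaginary axis accumulates at `0` and the strip is connected. On this axis
`spread` stays in the unit torus, where identities are easy to verify. -/
theorem eqOn_strip_of_eq_on_imaginary_axis {f g : ℂ → ℂ} (hf : AnalyticOnNhd ℂ f strip)
    (hg : AnalyticOnNhd ℂ g strip) (h : ∀ r : ℝ, f (r * Complex.I) = g (r * Complex.I)) :
    EqOn f g strip := by
  refine hf.eqOn_of_preconnected_of_frequently_eq hg isPreconnected_strip (z₀ := 0)
    (by simp [strip]) ?_
  have ht : Tendsto (fun r : ℝ => (r : ℂ) * Complex.I) (𝓝[≠] 0) (𝓝[≠] 0) := by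
    refine tendsto_nhdsWithin_iff.2 ⟨?_, ?_⟩
    · exact (Continuous.tendsto' (by fun_prop) _ _ (by simp)).mono_left nhdsWithin_le_nhds
    · filter_upwards [self_mem_nhdsWithin] with r hr
      simpa using hr
  exact ht.frequently (Eventually.of_forall h).frequently

/-- The point of the torus `{|z| = exp (Re s • v)}` with arguments `θ + Im s • v`. -/
def spread (v : Fin 2 → ℝ) (θ : UnitAddTorus (Fin 2)) (s : ℂ) : Fin 2 → ℂ :=
  fun i => ((θ i).toCircle : ℂ) * Complex.exp (s * v i)

/-- The union of the tori `{|z| = exp (t • v)}`, `-1 ≤ t ≤ 1`. -/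
def slab (v : Fin 2 → ℝ) : Set (Fin 2 → ℂ) :=
  {z | ∃ t ∈ Icc (-1 : ℝ) 1, ∀ i, ‖z i‖ = Real.exp (t * v i)}

variable {v : Fin 2 → ℝ}

theorem norm_spread (θ : UnitAddTorus (Fin 2)) (s : ℂ) (i : Fin 2) :
    ‖spread v θ s i‖ = Real.exp (s.re * v i) := by
  rw [spread, norm_mul, Circle.norm_coe, Complex.norm_exp]
  simp

theorem spread_mem_slab (θ : UnitAddTorus (Fin 2)) {s : ℂ} (hs : s ∈ strip) :
    spread v θ s ∈ slab v := ⟨s.re, hs, norm_spread θ s⟩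

theorem spread_zero (θ : UnitAddTorus (Fin 2)) :
    spread v θ 0 = toC2 fun i => (θ i).toCircle := by
  ext i; simp [spread, toC2]

theorem spread_one_mem (θ : UnitAddTorus (Fin 2)) :
    spread v θ 1 ∈ polyTorus fun i => Real.exp (v i) := fun i => by
  simp [norm_spread]

theorem exists_toCircle_eq (z : Circle) : ∃ t : UnitAddCircle, t.toCircle = z :=
  ⟨(AddCircle.homeomorphCircle one_ne_zero).symm z, by
    rw [← AddCircle.homeomorphCircle_apply one_ne_zero, Homeomorph.apply_symm_apply]⟩

theorem exists_spread_eq {z : Fin 2 → ℂ} {t : ℝ} (h : ∀ i, ‖z i‖ = Real.exp (t * v i)) :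
    ∃ θ, spread v θ t = z := by
  have h1 : ∀ i, ∃ θ : UnitAddCircle, (θ.toCircle : ℂ) * Complex.exp (t * v i) = z i := by
    intro i
    obtain ⟨θ, hθ⟩ := exists_toCircle_eq
      ⟨z i / Complex.exp (t * v i), mem_sphere_zero_iff_norm.2 <| by
        rw [norm_div, h, Complex.norm_exp]
        simp⟩
    exact ⟨θ, by rw [hθ]; exact div_mul_cancel₀ _ (Complex.exp_ne_zero _)⟩
  choose θ hθ using h1
  exact ⟨θ, funext hθ⟩

/-- Moving the parameter vertically only rotates the torus. This lets invariance of Haar measure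
enter. -/
theorem spread_add_mul_I (θ : UnitAddTorus (Fin 2)) (s : ℂ) (r : ℝ) :
    spread v θ (s + r * Complex.I) =
      spread v (θ + fun i => ((r * v i / (2 * Real.pi) : ℝ) : UnitAddCircle)) s := by
  ext i
  have h : (AddCircle.toCircle ((r * v i / (2 * Real.pi) : ℝ) : UnitAddCircle) : ℂ) =
      Complex.exp (r * Complex.I * v i) := by
    rw [AddCircle.toCircle_apply_mk, Circle.coe_exp]
    congr 1
    push_cast
    have : (Real.pi : ℂ) ≠ 0 := by exact_mod_cast Real.pi_ne_zero
    field_simp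
  simp only [spread, Pi.add_apply, AddCircle.toCircle_add, Circle.coe_mul, h, add_mul,
    Complex.exp_add]
  ring

theorem continuous_spread : Continuous fun p : ℂ × UnitAddTorus (Fin 2) => spread v p.2 p.1 := by
  have h : Continuous (AddCircle.toCircle (T := 1)) := AddCircle.continuous_toCircle
  refine continuous_pi fun i => ?_
  unfold spread
  fun_prop

theorem differentiable_spread (θ : UnitAddTorus (Fin 2)) : Differentiable ℂ (spread v θ) := by
  refine differentiable_pi.2 fun i => ?_
  unfold spread
  fun_prop

theorem prod_spread_zpow (θ : UnitAddTorus (Fin 2)) (s : ℂ) (n : Fin 2 → ℤ) :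
    ∏ i, spread v θ s i ^ n i =
      UnitAddTorus.mFourier n θ * Complex.exp (s * (∑ i, n i * v i : ℝ)) := by
  simp only [UnitAddTorus.mFourier, ContinuousMap.coe_mk, fourier_apply, Fin.prod_univ_two,
    Fin.sum_univ_two, spread, mul_zpow, AddCircle.toCircle_zsmul, Circle.coe_zpow,
    ← Complex.exp_int_mul]
  push_cast
  rw [mul_add, Complex.exp_add, mul_left_comm s, mul_left_comm s]
  ring

/-- A neighbourhood of `slab v` contains all tori whose parameter lies in a neighbourhood of the
strip. -/
theorem exists_isOpen_strip_subset {U : Set (Fin 2 → ℂ)} (hU : IsOpen U) (hv : slab v ⊆ U) :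
    ∃ S : Set ℂ, IsOpen S ∧ strip ⊆ S ∧ ∀ s ∈ S, ∀ θ, spread v θ s ∈ U := by
  refine ⟨{s | ∀ θ, spread v θ s ∈ U}, ?_, fun s hs θ => hv (spread_mem_slab θ hs),
    fun s hs => hs⟩
  refine isOpen_iff_eventually.2 fun s hs => ?_
  have h := isCompact_univ.eventually_forall_of_forall_eventually
    (P := fun s θ => spread v θ s ∈ U) (x₀ := s) fun θ _ =>
      (continuous_spread.tendsto (s, θ)).eventually (hU.mem_nhds (hs θ))
  filter_upwards [h] with s' hs' θ using hs' θ (mem_univ _)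

theorem analyticOnNhd_comp_spread {U : Set (Fin 2 → ℂ)} (hU : IsOpen U) (hv : slab v ⊆ U)
    {f : (Fin 2 → ℂ) → ℂ} (hf : DifferentiableOn ℂ f U) (θ : UnitAddTorus (Fin 2)) :
    AnalyticOnNhd ℂ (fun s => f (spread v θ s)) strip := by
  obtain ⟨S, hS, hsub, hSU⟩ := exists_isOpen_strip_subset hU hv
  refine (DifferentiableOn.analyticOnNhd ?_ hS).mono hsub
  exact hf.comp (differentiable_spread θ).differentiableOn fun s hs => hSU s hs θ

/-- A function that is holomorphic near the tori `{|z| = exp (t • v)}` and unimodular on the unit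
torus has no zeros on these tori, by reflection. -/
theorem ne_zero_of_norm_eq_one {U : Set (Fin 2 → ℂ)} (hU : IsOpen U) (hv : slab v ⊆ U)
    {f : (Fin 2 → ℂ) → ℂ} (hf : DifferentiableOn ℂ f U)
    (h1 : ∀ z : Fin 2 → Circle, ‖f (toC2 z)‖ = 1) {z : Fin 2 → ℂ} (hz : z ∈ slab v) : f z ≠ 0 := by
  obtain ⟨t, ht, hzt⟩ := hz
  obtain ⟨θ, rfl⟩ := exists_spread_eq hzt
  have hu := analyticOnNhd_comp_spread hU hv hf θ
  obtain ⟨S, hS, hsub, hSU⟩ := exists_isOpen_strip_subset hU hv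
  have hd : DifferentiableOn ℂ (fun s => f (spread v θ s)) S :=
    hf.comp (differentiable_spread θ).differentiableOn fun s hs => hSU s hs θ
  have hS' : IsOpen ((fun s : ℂ => -conj s) ⁻¹' S) :=
    hS.preimage (by fun_prop)
  -- The reflection `s ↦ -conj s` fixes the imaginary axis pointwise. There the product of `f` with
  -- its reflected conjugate is `‖f‖ ^ 2 = 1`, hence it is `1` on the whole strip and `f` cannot
  -- vanish.
  have hw : AnalyticOnNhd ℂ (fun s => conj (f (spread v θ (-conj s)))) strip := by
    refine (DifferentiableOn.analyticOnNhd (s := (fun s : ℂ => -conj s) ⁻¹' S) ?_ hS').mono ?_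
    · intro s hs
      have hs' : -conj s ∈ S := hs
      have h2 : DifferentiableAt ℂ (fun s => f (spread v θ s)) (-conj s) :=
        hd.differentiableAt (hS.mem_nhds hs')
      have h3 : DifferentiableAt ℂ (fun s => f (spread v θ (-s))) (conj s) :=
        h2.comp (conj s) (f := fun s => -s) differentiableAt_id.neg
      have h4 := h3.conj_conj
      simp only [Complex.conj_conj] at h4
      exact h4.differentiableWithinAt
    · intro s hs
      refine hsub ?_
      simp only [strip, mem_ofPred_eq, mem_Icc, Complex.neg_re, Complex.conj_re] at hs ⊢
      constructor <;> linarith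
  have hone := eqOn_strip_of_eq_on_imaginary_axis (hu.mul hw)
    (analyticOnNhd_const (v := (1 : ℂ))) fun r => by
      have h2 : -conj ((r : ℂ) * Complex.I) = r * Complex.I := by simp
      have h3 := spread_add_mul_I (v := v) θ 0 r
      rw [zero_add, spread_zero] at h3
      simp only [h2]
      rw [Complex.mul_conj', h3, h1]
      simp
  have ht' : (t : ℂ) ∈ strip := by simpa [strip] using ht
  intro h0
  have := hone ht'
  simp [h0] at this

/-- Parseval's identity; the total mass is `1`, so the sup norm dominates the `L²` norm. -/
theorem mFourierCoeff_sq_sum_le {g : UnitAddTorus (Fin 2) → ℂ} (hg : Continuous g) {M : ℝ}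
    (hM : ∀ θ, ‖g θ‖ ≤ M) (S : Finset (Fin 2 → ℤ)) :
    ∑ n ∈ S, ‖UnitAddTorus.mFourierCoeff g n‖ ^ 2 ≤ M ^ 2 := by
  let g' : C(UnitAddTorus (Fin 2), ℂ) := ⟨g, hg⟩
  have h := UnitAddTorus.hasSum_sq_mFourierCoeff (ContinuousMap.toLp 2 volume ℂ g')
  simp only [UnitAddTorus.mFourierCoeff_toLp] at h
  refine (sum_le_hasSum S (fun _ _ => by positivity) h).trans ?_
  have h2 : ∫ t, ‖(ContinuousMap.toLp 2 (volume : Measure (UnitAddTorus (Fin 2))) ℂ g') t‖ ^ 2 =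
      ∫ t, ‖g t‖ ^ 2 := by
    refine integral_congr_ae ?_
    filter_upwards [ContinuousMap.coeFn_toLp (p := 2) (𝕜 := ℂ) volume g'] with t ht
    rw [ht]; rfl
  refine h2.le.trans ?_
  calc ∫ t, ‖g t‖ ^ 2 ≤ ∫ _t : UnitAddTorus (Fin 2), M ^ 2 := by
        refine integral_mono_of_nonneg (Eventually.of_forall fun _ => by positivity)
          (integrable_const _) (Eventually.of_forall fun t => ?_)
        exact pow_le_pow_left₀ (norm_nonneg _) (hM t) 2
    _ = M ^ 2 := by simp

/-- The Laurent coefficients of a function that is holomorphic near the tori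
`{|z| = exp (t • v)}` can be computed on each of these tori. -/
theorem mFourierCoeff_spread_one {U : Set (Fin 2 → ℂ)} (hU : IsOpen U) (hv : slab v ⊆ U)
    {f : (Fin 2 → ℂ) → ℂ} (hf : DifferentiableOn ℂ f U) (n : Fin 2 → ℤ) :
    UnitAddTorus.mFourierCoeff (fun θ => f (spread v θ 1)) n =
      Complex.exp (∑ i, n i * v i : ℝ) *
        UnitAddTorus.mFourierCoeff (fun θ => f (toC2 fun i => (θ i).toCircle)) n := by
  obtain ⟨S, hS, hsub, hSU⟩ := exists_isOpen_strip_subset hU hv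
  let h : ℂ → UnitAddTorus (Fin 2) → ℂ := fun s θ =>
    f (spread v θ s) * (∏ i, spread v θ s i ^ (-n) i)
  have hspread_ne : ∀ (θ : UnitAddTorus (Fin 2)) s i, spread v θ s i ≠ 0 := fun θ s i => by
    rw [← norm_pos_iff, norm_spread]; positivity
  have hcont : ContinuousOn (Function.uncurry h) (S ×ˢ univ) := by
    refine ContinuousOn.mul ?_ (Continuous.continuousOn ?_)
    · exact hf.continuousOn.comp continuous_spread.continuousOn fun p hp => hSU _ hp.1 _
    · refine continuous_finsetProd _ fun i _ => ?_
      exact ((continuous_apply i).comp continuous_spread).zpow₀ _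
        fun p => Or.inl (hspread_ne _ _ _)
  have hdiff : ∀ θ ∈ (univ : Set (UnitAddTorus (Fin 2))),
      DifferentiableOn ℂ (fun s => h s θ) S := by
    intro θ _
    refine DifferentiableOn.mul ?_ (Differentiable.differentiableOn ?_)
    · exact hf.comp (differentiable_spread θ).differentiableOn fun s hs => hSU s hs θ
    · refine Differentiable.fun_finsetProd fun i _ => ?_
      intro s
      exact ((differentiable_pi.1 (differentiable_spread θ) i) s).zpow (Or.inl (hspread_ne _ _ _))
  have hI : DifferentiableOn ℂ (fun s => ∫ θ in univ, h s θ) S :=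
    differentiableOn_setIntegral_param volume hS isCompact_univ hcont hdiff
  simp only [setIntegral_univ] at hI
  -- For imaginary `s` the integrand is a translate of the one at `s = 0`, so the integral is
  -- constant on the axis; being holomorphic in `s`, it is constant on the strip.
  have hconst := eqOn_strip_of_eq_on_imaginary_axis ((hI.analyticOnNhd hS).mono hsub)
    (analyticOnNhd_const (v := ∫ θ, h 0 θ)) fun r => by
      have h1 : ∀ θ, h (r * Complex.I) θ =
          h 0 (θ + fun i => ((r * v i / (2 * Real.pi) : ℝ) : UnitAddCircle)) := fun θ => by
        have := spread_add_mul_I (v := v) θ 0 r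
        rw [zero_add] at this
        simp only [h, this]
      simp only [h1]
      exact integral_add_right_eq_self (h 0) _
  have h1 := hconst (show (1 : ℂ) ∈ strip by simp [strip])
  simp only [h, prod_spread_zpow, spread_zero] at h1
  have he : Complex.exp (1 * (∑ i, ((-n) i : ℤ) * v i : ℝ)) =
      (Complex.exp (∑ i, n i * v i : ℝ))⁻¹ := by
    rw [← Complex.exp_neg]
    simp
  simp only [he, zero_mul, Complex.exp_zero, mul_one] at h1
  rw [UnitAddTorus.mFourierCoeff, UnitAddTorus.mFourierCoeff,
    ← inv_mul_eq_iff_eq_mul₀ (Complex.exp_ne_zero _), ← integral_const_mul]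
  simp only [smul_eq_mul]
  refine Eq.trans ?_ (h1.trans ?_)
  · exact integral_congr_ae (Eventually.of_forall fun θ => by ring)
  · exact integral_congr_ae (Eventually.of_forall fun θ => by ring)

/-- Bessel's inequality on the torus `{|z| = exp v}` for the Laurent coefficients. -/
theorem laurentCoeff_sq_sum_le {U : Set (Fin 2 → ℂ)} (hU : IsOpen U) (hv : slab v ⊆ U)
    {f : (Fin 2 → ℂ) → ℂ} (hf : DifferentiableOn ℂ f U) {M : ℝ}
    (hM : ∀ z ∈ polyTorus fun i => Real.exp (v i), ‖f z‖ ≤ M) (S : Finset (Fin 2 → ℤ)) :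
    ∑ n ∈ S, ‖UnitAddTorus.mFourierCoeff (fun θ => f (toC2 fun i => (θ i).toCircle)) n‖ ^ 2 *
      Real.exp (∑ i, n i * v i) ^ 2 ≤ M ^ 2 := by
  have hc : Continuous fun θ : UnitAddTorus (Fin 2) => f (spread v θ 1) := by
    refine hf.continuousOn.comp_continuous (continuous_spread.comp (by fun_prop :
      Continuous fun θ : UnitAddTorus (Fin 2) => ((1 : ℂ), θ))) fun θ => hv (spread_mem_slab θ ?_)
    simp [strip]
  refine le_trans (le_of_eq ?_) (mFourierCoeff_sq_sum_le hc (fun θ => hM _ (spread_one_mem θ)) S)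
  refine Finset.sum_congr rfl fun n _ => ?_
  rw [mFourierCoeff_spread_one hU hv hf, norm_mul, mul_pow, Complex.norm_exp, mul_comm]
  simp

end Spread

/-! ### Fundamental domains and lifts of torus maps -/

/-- The covering `ℝ² → (ℝ / ℤ)²`. -/
def torusCover : (Fin 2 → ℝ) →+ UnitAddTorus (Fin 2) where
  toFun x i := (x i : UnitAddCircle)
  map_zero' := by ext i; simp
  map_add' x y := by ext i; simp

theorem torusCover_apply (x : Fin 2 → ℝ) (i : Fin 2) :
    torusCover x i = (x i : UnitAddCircle) := rfl

theorem continuous_torusCover : Continuous torusCover :=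
  continuous_pi fun i => (AddCircle.continuous_mk' 1).comp (continuous_apply i)

/-- The kernel is `ℤ²`. Countability is needed to compare integrals over two fundamental domains. -/
instance : Countable torusCover.ker := by
  have h : ∀ x : torusCover.ker, ∃ n : Fin 2 → ℤ, ∀ i, (n i : ℝ) = x.1 i := by
    intro x
    have h1 : ∀ i, ∃ n : ℤ, (n : ℝ) = x.1 i := fun i => by
      have h2 : ((x.1 i : ℝ) : UnitAddCircle) = 0 := congr_fun (AddMonoidHom.mem_ker.1 x.2) i
      obtain ⟨n, hn⟩ := (AddCircle.coe_eq_zero_iff 1).1 h2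
      exact ⟨n, by simpa using hn⟩
    choose n hn using h1
    exact ⟨n, hn⟩
  choose f hf using h
  refine Function.Injective.countable (f := f) fun x y hxy => ?_
  ext i
  rw [← hf, ← hf, hxy]

/-- A measurable set of representatives for `(ℝ / ℤ)²` is a fundamental domain. -/
theorem isAddFundamentalDomain_of_bijOn {s : Set (Fin 2 → ℝ)} (hs : MeasurableSet s)
    (h : BijOn torusCover s univ) : IsAddFundamentalDomain torusCover.ker s := by
  refine IsAddFundamentalDomain.mk' hs.nullMeasurableSet fun x => ?_
  obtain ⟨y, hy, hxy⟩ := h.surjOn (mem_univ (torusCover x))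
  refine ⟨⟨y - x, by simp [AddMonoidHom.mem_ker, hxy]⟩, ?_, ?_⟩
  · simpa [AddSubgroup.vadd_def] using hy
  · rintro ⟨k, hk⟩ hkx
    have hkx' : k + x ∈ s := hkx
    have h1 : torusCover (k + x) = torusCover y := by
      rw [map_add, AddMonoidHom.mem_ker.1 hk, zero_add, hxy]
    ext1
    exact eq_sub_of_add_eq (h.injOn hkx' hy h1)

/-- The half-open unit cube. -/
def unitCube : Set (Fin 2 → ℝ) := {x | ∀ i, x i ∈ Ioc (0 : ℝ) (0 + 1)}

theorem measurableSet_unitCube : MeasurableSet unitCube :=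
  MeasurableSet.univ_pi' fun _ => measurableSet_Ioc

theorem bijOn_torusCover_unitCube : BijOn torusCover unitCube univ := by
  refine ⟨fun _ _ => mem_univ _, fun x hx y hy h => ?_, fun t _ => ?_⟩
  · ext i
    have h1 := congr_fun h i
    have := (AddCircle.equivIoc (1 : ℝ) 0).symm.injective (a₁ := ⟨x i, hx i⟩) (a₂ := ⟨y i, hy i⟩) h1
    exact congr_arg Subtype.val this
  · refine ⟨fun i => (AddCircle.equivIoc (1 : ℝ) 0 (t i)).1,
      fun i => (AddCircle.equivIoc (1 : ℝ) 0 (t i)).2, ?_⟩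
    ext i
    exact (AddCircle.equivIoc (1 : ℝ) 0).symm_apply_apply (t i)

theorem integral_torus_eq (u : UnitAddTorus (Fin 2) → ℂ) :
    ∫ θ, u θ = ∫ x in unitCube, u (torusCover x) :=
  UnitAddTorus.integral_preimage u fun _ => 0

/-- Change of variables on the torus for a bijection with a differentiable lift. -/
theorem integral_torus_eq_of_lift (τ : UnitAddTorus (Fin 2) ≃ UnitAddTorus (Fin 2))
    {g : (Fin 2 → ℝ) → (Fin 2 → ℝ)} {g' : (Fin 2 → ℝ) → (Fin 2 → ℝ) →L[ℝ] (Fin 2 → ℝ)}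
    (hg : ∀ x, HasFDerivAt g (g' x) x) (hlift : ∀ x, torusCover (g x) = τ (torusCover x))
    (u : UnitAddTorus (Fin 2) → ℂ) :
    ∫ θ, u θ = ∫ x in unitCube, |(g' x).det| • u (τ (torusCover x)) := by
  have hinj : InjOn g unitCube := fun x hx y hy hxy =>
    bijOn_torusCover_unitCube.injOn hx hy (τ.injective (by rw [← hlift, ← hlift, hxy]))
  have hg' : ∀ x ∈ unitCube, HasFDerivWithinAt g (g' x) unitCube x :=
    fun x _ => (hg x).hasFDerivWithinAt
  have hmeas : MeasurableSet (g '' unitCube) :=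
    measurable_image_of_fderivWithin measurableSet_unitCube hg' hinj
  -- The lift carries the cube to another set of representatives, so a periodic function has the
  -- same integral over both.
  have hbij : BijOn torusCover (g '' unitCube) univ := by
    refine ⟨fun _ _ => mem_univ _, ?_, fun t _ => ?_⟩
    · rintro _ ⟨x, hx, rfl⟩ _ ⟨y, hy, rfl⟩ hxy
      rw [hlift, hlift] at hxy
      rw [bijOn_torusCover_unitCube.injOn hx hy (τ.injective hxy)]
    · obtain ⟨x, hx, hxt⟩ := bijOn_torusCover_unitCube.surjOn (mem_univ (τ.symm t))
      exact ⟨g x, mem_image_of_mem g hx, by rw [hlift, hxt, τ.apply_symm_apply]⟩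
  have h1 := (isAddFundamentalDomain_of_bijOn measurableSet_unitCube
    bijOn_torusCover_unitCube).setIntegral_eq (isAddFundamentalDomain_of_bijOn hmeas hbij)
    (f := fun x => u (torusCover x)) (by
      rintro ⟨k, hk⟩ x
      change u (torusCover (k + x)) = _
      rw [map_add, AddMonoidHom.mem_ker.1 hk, zero_add])
  rw [integral_torus_eq, h1, integral_image_eq_integral_abs_det_fderiv_smul volume
    measurableSet_unitCube hg' hinj]
  simp only [hlift]

/-- Each coordinate lifts through the covering `ℝ → ℝ / ℤ`, since `ℝ²` is simply connected. -/
theorem exists_continuous_lift {τ : UnitAddTorus (Fin 2) → UnitAddTorus (Fin 2)}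
    (hτ : Continuous τ) :
    ∃ g : (Fin 2 → ℝ) → (Fin 2 → ℝ), Continuous g ∧ ∀ x, torusCover (g x) = τ (torusCover x) := by
  have h : ∀ i, ∃ f : C(Fin 2 → ℝ, ℝ), ∀ x, (f x : UnitAddCircle) = τ (torusCover x) i := by
    intro i
    let c : C(Fin 2 → ℝ, UnitAddCircle) :=
      ⟨fun x => τ (torusCover x) i, (continuous_apply i).comp (hτ.comp continuous_torusCover)⟩
    obtain ⟨e₀, he₀⟩ := QuotientAddGroup.mk_surjective (c 0)
    obtain ⟨f, hf, -⟩ := (AddCircle.isCoveringMap_coe (1 : ℝ)).existsUnique_continuousMap_lifts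
      c 0 e₀ he₀
    exact ⟨f, fun x => congr_fun hf.2 x⟩
  choose f hf using h
  exact ⟨fun x i => f i x, by fun_prop, fun x => funext fun i => hf i x⟩

/-- A continuous argument of a differentiable unimodular function is differentiable. -/
theorem exists_hasFDerivAt_arg {E : Type*} [NormedAddCommGroup E] [NormedSpace ℝ E]
    {c : E → ℂ} {c' : E →L[ℝ] ℂ} {x₀ : E} (hc : HasFDerivAt c c' x₀) {g : E → ℝ}
    (hg : ContinuousAt g x₀) (h : ∀ x, c x = Complex.exp (2 * Real.pi * Complex.I * g x)) :
    ∃ g' : E →L[ℝ] ℝ, HasFDerivAt g g' x₀ ∧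
      ∀ w, c' w = 2 * Real.pi * Complex.I * c x₀ * g' w := by
  have hne : c x₀ ≠ 0 := by rw [h]; exact Complex.exp_ne_zero _
  have h1 : HasFDerivAt (fun x => Complex.log (c x * (c x₀)⁻¹)) ((c x₀)⁻¹ • c') x₀ := by
    have h2 := (Complex.hasStrictFDerivAt_log_real (x := c x₀ * (c x₀)⁻¹)
      (by simp [hne])).hasFDerivAt.comp x₀ (hc.mul_const' (c x₀)⁻¹)
    refine h2.congr_fderiv ?_
    ext w
    simp [hne, mul_comm]
  -- Where `|g x - g x₀| < 1 / 2`, the argument of `c x / c x₀` lies in `(-π, π)`, so the principal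
  -- logarithm recovers `g x - g x₀` without a jump.
  have h2 : (fun x => (2 * Real.pi)⁻¹ * (Complex.log (c x * (c x₀)⁻¹)).im + g x₀) =ᶠ[𝓝 x₀] g := by
    have h3 := Metric.tendsto_nhds.1 hg (1 / 2) (by norm_num)
    filter_upwards [h3] with x hx
    rw [Real.dist_eq, abs_lt] at hx
    have h4 : c x * (c x₀)⁻¹ = Complex.exp ((2 * Real.pi * (g x - g x₀) : ℝ) * Complex.I) := by
      rw [h, h, ← Complex.exp_neg, ← Complex.exp_add]
      congr 1
      push_cast
      ring
    have hπ := Real.pi_pos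
    have him : ((2 * Real.pi * (g x - g x₀) : ℝ) * Complex.I).im = 2 * Real.pi * (g x - g x₀) := by
      rw [Complex.im_ofReal_mul, Complex.I_im, mul_one]
    rw [h4, Complex.log_exp (by rw [him]; nlinarith) (by rw [him]; nlinarith), him]
    field_simp
    ring
  have h5 : HasFDerivAt g ((2 * Real.pi)⁻¹ • (Complex.imCLM ∘L ((c x₀)⁻¹ • c'))) x₀ := by
    refine HasFDerivAt.congr_of_eventuallyEq ?_ h2.symm
    exact ((Complex.imCLM.hasFDerivAt.comp x₀ h1).const_mul _).add_const _
  refine ⟨_, h5, fun w => ?_⟩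
  -- Differentiating `c = exp (2 π i g)` again and using uniqueness of the derivative yields the
  -- formula for `c'`.
  have h6 : HasFDerivAt c ((c x₀) • (((2 * Real.pi * Complex.I : ℂ)) • (Complex.ofRealCLM ∘L
      ((2 * Real.pi)⁻¹ • (Complex.imCLM ∘L ((c x₀)⁻¹ • c')))))) x₀ := by
    have h7 := ((Complex.ofRealCLM.hasFDerivAt.comp x₀ h5).const_mul
      (2 * Real.pi * Complex.I : ℂ)).cexp
    refine (h7.congr_of_eventuallyEq (Eventually.of_forall fun x => h x)).congr_fderiv ?_
    simp only [Function.comp_apply, Complex.ofRealCLM_apply, ← h]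
  have h8 := congr_arg (fun L : E →L[ℝ] ℂ => L w) (hc.unique h6)
  refine h8.trans ?_
  simp only [smul_apply, ContinuousLinearMap.comp_apply, smul_eq_mul,
    Complex.ofRealCLM_apply]
  ring

/-! ### Logarithmic Jacobian and change of variables under torus maps -/

/-- The parametrisation `x ↦ (exp (2 π i x₁), exp (2 π i x₂))` of the unit torus. -/
def torusExp (x : Fin 2 → ℝ) : Fin 2 → ℂ := toC2 fun i => (torusCover x i).toCircle

theorem torusExp_apply (x : Fin 2 → ℝ) (i : Fin 2) :
    torusExp x i = Complex.exp (2 * Real.pi * Complex.I * x i) := by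
  rw [torusExp, toC2, torusCover_apply, AddCircle.toCircle_apply_mk, Circle.coe_exp]
  congr 1
  push_cast
  ring

theorem torusExp_ne_zero (x : Fin 2 → ℝ) (i : Fin 2) : torusExp x i ≠ 0 := by
  rw [torusExp_apply]; exact Complex.exp_ne_zero _

theorem exists_hasFDerivAt_torusExp (x : Fin 2 → ℝ) :
    ∃ E' : (Fin 2 → ℝ) →L[ℝ] (Fin 2 → ℂ), HasFDerivAt torusExp E' x ∧
      ∀ w i, E' w i = 2 * Real.pi * Complex.I * torusExp x i * w i := by
  refine ⟨ContinuousLinearMap.pi fun i => torusExp x i • ((2 * Real.pi * Complex.I : ℂ) •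
    (Complex.ofRealCLM ∘L (ContinuousLinearMap.proj i))), ?_, fun w i => ?_⟩
  · refine hasFDerivAt_pi.2 fun i => ?_
    have h1 : HasFDerivAt (fun y : Fin 2 → ℝ => (y i : ℂ))
        (Complex.ofRealCLM ∘L (ContinuousLinearMap.proj i)) x :=
      (Complex.ofRealCLM ∘L
        (ContinuousLinearMap.proj (R := ℝ) (φ := fun _ : Fin 2 => ℝ) i)).hasFDerivAt
    have h2 := (h1.const_mul (2 * Real.pi * Complex.I : ℂ)).cexp
    refine (h2.congr_of_eventuallyEq
      (Eventually.of_forall fun y => torusExp_apply y i)).congr_fderiv ?_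
    rw [torusExp_apply]
  · simp only [ContinuousLinearMap.pi_apply, smul_apply, ContinuousLinearMap.comp_apply,
      smul_eq_mul, Complex.ofRealCLM_apply, ContinuousLinearMap.proj_apply]
    ring

theorem continuous_torusExp : Continuous torusExp := by
  refine continuous_pi fun i => ?_
  simp only [torusExp_apply]
  fun_prop

/-- The matrix `z_b ∂_b G_a / G_a`, that is, the Jacobian matrix of `G` in logarithmic
coordinates. -/
def logJacobian (G : (Fin 2 → ℂ) → (Fin 2 → ℂ)) (z : Fin 2 → ℂ) : Matrix (Fin 2) (Fin 2) ℂ :=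
  Matrix.of fun a b => z b * fderiv ℂ (fun z => G z a) z (Pi.single b 1) / G z a

theorem differentiableOn_det_logJacobian {V : Set (Fin 2 → ℂ)} (hV : IsOpen V)
    {G : (Fin 2 → ℂ) → (Fin 2 → ℂ)} (hG : DifferentiableOn ℂ G V) (h0 : ∀ z ∈ V, ∀ i, G z i ≠ 0) :
    DifferentiableOn ℂ (fun z => (logJacobian G z).det) V := by
  have hGa : ∀ a, DifferentiableOn ℂ (fun z => G z a) V := differentiableOn_pi.1 hG
  have h : ∀ a b, DifferentiableOn ℂ (fun z => logJacobian G z a b) V := by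
    intro a b
    simp only [logJacobian, Matrix.of_apply]
    simp only [div_eq_mul_inv]
    refine DifferentiableOn.mul (DifferentiableOn.mul (by fun_prop) ?_)
      ((hGa a).fun_inv fun z hz => h0 z hz a)
    exact differentiableOn_fderiv_apply hV (hGa a) _
  simp only [Matrix.det_fin_two]
  exact ((h 0 0).mul (h 1 1)).sub ((h 0 1).mul (h 1 0))

theorem isOpen_inter_ne_zero {U : Set (Fin 2 → ℂ)} (hU : IsOpen U) {F : (Fin 2 → ℂ) → (Fin 2 → ℂ)}
    (hF : ContinuousOn F U) : IsOpen (U ∩ {z | ∀ i, F z i ≠ 0}) := by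
  have h : {z | ∀ i, F z i ≠ 0} = F ⁻¹' {w | ∀ i, w i ≠ 0} := rfl
  rw [h]
  refine hF.isOpen_inter_preimage hU ?_
  simp only [ofPred_forall]
  exact isOpen_iInter_of_finite fun i => isOpen_ne.preimage (continuous_apply i)

/-- Change of variables on the torus for the inverse of a map with holomorphic extension `F`: up to
a unimodular constant, the density is the determinant of the logarithmic Jacobian matrix. -/
theorem integral_torus_comp_eq (T : (Fin 2 → Circle) ≃ (Fin 2 → Circle))
    {F G : (Fin 2 → ℂ) → (Fin 2 → ℂ)} {U V : Set (Fin 2 → ℂ)} (hU : IsOpen U) (hV : IsOpen V)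
    (hFU : DifferentiableOn ℂ F U) (hGV : DifferentiableOn ℂ G V)
    (hUT : ∀ z, toC2 z ∈ U) (hVT : ∀ z, toC2 z ∈ V) (hF : ∀ z, F (toC2 z) = toC2 (T z))
    (hG : ∀ z, G (toC2 z) = toC2 (T.symm z)) :
    ∃ ε : ℂ, ‖ε‖ = 1 ∧ ∀ u : (Fin 2 → Circle) → ℂ,
      ∫ θ : UnitAddTorus (Fin 2), u (fun i => (θ i).toCircle) =
      ∫ θ : UnitAddTorus (Fin 2), ε * (logJacobian G (toC2 fun i => (θ i).toCircle)).det *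
        u (T.symm fun i => (θ i).toCircle) := by
  let e : UnitAddTorus (Fin 2) ≃ (Fin 2 → Circle) :=
    Equiv.piCongrRight fun _ => (AddCircle.homeomorphCircle (T := 1) one_ne_zero).toEquiv
  have he : ∀ θ, e θ = fun i => (θ i).toCircle := fun θ => by
    ext1 i
    exact AddCircle.homeomorphCircle_apply one_ne_zero _
  let τ : UnitAddTorus (Fin 2) ≃ UnitAddTorus (Fin 2) := (e.trans T.symm).trans e.symm
  have heτ : ∀ θ, e (τ θ) = T.symm (e θ) := fun θ => e.apply_symm_apply _
  have hGE : ∀ x, G (torusExp x) = toC2 (e (τ (torusCover x))) := fun x => by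
    rw [heτ, he, ← hG]; rfl
  have hEV : ∀ x, torusExp x ∈ V := fun x => hVT _
  have hGEc : Continuous fun x => G (torusExp x) :=
    hGV.continuousOn.comp_continuous continuous_torusExp hEV
  have hτ : Continuous τ := by
    have hGc : Continuous fun θ => G (toC2 (e θ)) := by
      refine hGV.continuousOn.comp_continuous ?_ fun θ => hVT _
      refine continuous_pi fun i => ?_
      simp only [he, toC2]
      exact continuous_subtype_val.comp (AddCircle.continuous_toCircle.comp (continuous_apply i))
    refine continuous_pi fun i => ?_
    have h1 : Continuous fun θ => (T.symm (e θ)) i := by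
      refine Topology.IsEmbedding.subtypeVal.continuous_iff.2 ?_
      refine ((continuous_apply i).comp hGc).congr fun θ => ?_
      simp only [Function.comp_apply, hG]
      rfl
    exact (AddCircle.homeomorphCircle (T := 1) one_ne_zero).symm.continuous.comp h1
  obtain ⟨g, hg, hlift⟩ := exists_continuous_lift hτ
  have hGg : ∀ x, G (torusExp x) = torusExp (g x) := fun x => by
    rw [hGE, ← hlift, he]; rfl
  have hderiv : ∀ x, ∃ g' : (Fin 2 → ℝ) →L[ℝ] (Fin 2 → ℝ), HasFDerivAt g g' x ∧ g'.det ≠ 0 ∧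
      ((g'.det : ℝ) : ℂ) = (logJacobian G (torusExp x)).det := by
    intro x
    obtain ⟨E', hE', hE'w⟩ := exists_hasFDerivAt_torusExp x
    have hGd : HasFDerivAt G (fderiv ℂ G (torusExp x)) (torusExp x) :=
      (hGV.differentiableAt (hV.mem_nhds (hEV x))).hasFDerivAt
    have hc : HasFDerivAt (fun y => G (torusExp y))
        (((fderiv ℂ G (torusExp x)).restrictScalars ℝ).comp E') x :=
      (hGd.restrictScalars ℝ).comp x hE'
    have harg : ∀ a, ∃ ga' : (Fin 2 → ℝ) →L[ℝ] ℝ, HasFDerivAt (fun y => g y a) ga' x ∧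
        ∀ w, fderiv ℂ G (torusExp x) (E' w) a =
          2 * Real.pi * Complex.I * G (torusExp x) a * ga' w := by
      intro a
      exact exists_hasFDerivAt_arg (hasFDerivAt_pi'.1 hc a)
        ((continuous_apply a).comp hg).continuousAt fun y => by rw [hGg, torusExp_apply]
    choose ga' hga' hga'w using harg
    have hG0 : ∀ a, G (torusExp x) a ≠ 0 := fun a => by rw [hGg]; exact torusExp_ne_zero _ a
    have h2πI : (2 * Real.pi * Complex.I : ℂ) ≠ 0 := Complex.two_pi_I_ne_zero
    refine ⟨ContinuousLinearMap.pi ga', hasFDerivAt_pi.2 hga', fun h0 => ?_, ?_⟩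
    -- A kernel vector of the lifted derivative is killed by the derivative of `F ∘ G ∘ torusExp =
    -- torusExp`, which is injective.
    · obtain ⟨w, hw0, hw⟩ := Submodule.exists_mem_ne_zero_of_ne_bot
        (LinearMap.det_eq_zero_iff_ker_ne_bot.1 h0)
      have h1 : fderiv ℂ G (torusExp x) (E' w) = 0 := by
        ext a
        have h2 : ga' a w = 0 := congr_fun hw0 a
        rw [hga'w, h2]
        simp
      have hFd : HasFDerivAt F (fderiv ℂ F (G (torusExp x))) (G (torusExp x)) :=
        (hFU.differentiableAt (hU.mem_nhds (by rw [hGE]; exact hUT _))).hasFDerivAt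
      have h2 : HasFDerivAt (fun y => F (G (torusExp y)))
          (((fderiv ℂ F (G (torusExp x))).restrictScalars ℝ).comp
            (((fderiv ℂ G (torusExp x)).restrictScalars ℝ).comp E')) x :=
        (hFd.restrictScalars ℝ).comp x hc
      have h3 : (fun y => F (G (torusExp y))) = torusExp := by
        ext1 y
        rw [torusExp, hG, hF, T.apply_symm_apply]
      rw [h3] at h2
      have h4 : E' w = 0 := by
        rw [hE'.unique h2]
        simp [h1]
      refine hw (funext fun i => ?_)
      have h5 := congr_fun h4 i
      rw [hE'w] at h5
      simpa [torusExp_ne_zero] using h5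
    · have hM : ∀ a b, ((ga' a (Pi.single b 1) : ℝ) : ℂ) = logJacobian G (torusExp x) a b := by
        intro a b
        have h1 := hga'w a (Pi.single b 1)
        have h2 : E' (Pi.single b 1) =
            (2 * Real.pi * Complex.I * torusExp x b) • Pi.single b (1 : ℂ) := by
          ext i
          rw [hE'w]
          rcases eq_or_ne i b with rfl | hi
          · simp
          · simp [hi]
        have h3 : fderiv ℂ (fun z => G z a) (torusExp x) (Pi.single b 1) =
            fderiv ℂ G (torusExp x) (Pi.single b 1) a := by
          rw [(hasFDerivAt_pi'.1 hGd a).fderiv]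
          rfl
        rw [h2, map_smul, Pi.smul_apply, smul_eq_mul] at h1
        rw [logJacobian, Matrix.of_apply, h3, eq_div_iff (hG0 a)]
        refine mul_left_cancel₀ h2πI ?_
        linear_combination -h1
      rw [ContinuousLinearMap.det, ← LinearMap.det_toMatrix', Matrix.det_fin_two,
        Matrix.det_fin_two, ← hM, ← hM, ← hM, ← hM]
      simp [LinearMap.toMatrix'_apply]
  choose g' hg' hdet hdetJ using hderiv
  have hcont : Continuous fun x => (g' x).det := by
    have h1 : Continuous fun x => (logJacobian G (torusExp x)).det := by
      have hV0 := isOpen_inter_ne_zero hV hGV.continuousOn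
      refine (differentiableOn_det_logJacobian hV0 (hGV.mono inter_subset_left)
        fun z hz => hz.2).continuousOn.comp_continuous continuous_torusExp
          fun x => ⟨hEV x, fun i => ?_⟩
      rw [hGg]
      exact torusExp_ne_zero _ i
    refine (Complex.continuous_re.comp h1).congr fun x => ?_
    simp [← hdetJ]
  -- The determinant is continuous without zeros on the connected space `ℝ²`, so its sign is
  -- constant. Removing the absolute value in this way keeps the density holomorphic.
  obtain ⟨ε, hε, habs⟩ : ∃ ε : ℝ, |ε| = 1 ∧ ∀ x, |(g' x).det| = ε * (g' x).det := by
    by_cases hpos : ∀ x, 0 < (g' x).det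
    · exact ⟨1, by simp, fun x => by rw [abs_of_pos (hpos x), one_mul]⟩
    · push Not at hpos
      obtain ⟨x₀, hx₀⟩ := hpos
      refine ⟨-1, by simp, fun x => ?_⟩
      have hneg : (g' x).det ≤ 0 := by
        by_contra! hx
        obtain ⟨y, hy⟩ := mem_range_of_exists_le_of_exists_ge hcont ⟨x₀, hx₀⟩ ⟨x, hx.le⟩
        exact hdet y hy
      rw [abs_of_nonpos hneg]
      ring
  refine ⟨ε, by simpa using hε, fun u => ?_⟩
  have h1 := integral_torus_eq_of_lift τ hg' hlift fun θ => u (e θ)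
  simp only [← he]
  rw [h1, integral_torus_eq]
  refine setIntegral_congr_fun measurableSet_unitCube fun x _ => ?_
  simp only [habs, heτ, Complex.real_smul, Complex.ofReal_mul, hdetJ]
  rw [he]
  rfl

section Quadrants

/-! ### Bounded matrices between weighted `ℓ²` spaces -/

section BlockBound

variable {ι κ : Type*} {c : ι → κ → ℂ} {u : ι → ℝ} {v : κ → ℝ} {X X₁ X₂ : Set ι} {Y Y₁ Y₂ : Set κ}

/-- The infinite matrix `c`, restricted to rows in `X` and columns in `Y`, is bounded between the
weighted `ℓ²` spaces with weights `u` and `v`. -/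
def BlockBound (c : ι → κ → ℂ) (u : ι → ℝ) (v : κ → ℝ) (X : Set ι) (Y : Set κ) : Prop :=
  ∃ C : ℝ, 0 ≤ C ∧ ∀ (f : ι → ℂ) (S : Finset ι) (S' : Finset κ), ↑S ⊆ X → ↑S' ⊆ Y →
    ∑ n ∈ S', ‖∑ m ∈ S, f m * c m n‖ ^ 2 * v n ^ 2 ≤ C * ∑ m ∈ S, ‖f m‖ ^ 2 * u m ^ 2

theorem BlockBound.mono {u' : ι → ℝ} {v' : κ → ℝ} {X' : Set ι} {Y' : Set κ}
    (h : BlockBound c u v X Y) (hX : X' ⊆ X) (hY : Y' ⊆ Y) (hu : ∀ m ∈ X', |u m| ≤ |u' m|)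
    (hv : ∀ n ∈ Y', |v' n| ≤ |v n|) : BlockBound c u' v' X' Y' := by
  obtain ⟨C, hC, h⟩ := h
  refine ⟨C, hC, fun f S S' hS hS' => ?_⟩
  refine le_trans ?_ ((h f S S' (hS.trans hX) (hS'.trans hY)).trans ?_)
  · exact Finset.sum_le_sum fun n hn =>
      mul_le_mul_of_nonneg_left (sq_le_sq.2 (hv n (hS' hn))) (by positivity)
  · refine mul_le_mul_of_nonneg_left (Finset.sum_le_sum fun m hm => ?_) hC
    exact mul_le_mul_of_nonneg_left (sq_le_sq.2 (hu m (hS hm))) (by positivity)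

theorem BlockBound.union_right (h₁ : BlockBound c u v X Y₁) (h₂ : BlockBound c u v X Y₂) :
    BlockBound c u v X (Y₁ ∪ Y₂) := by
  classical
  obtain ⟨C₁, hC₁, h₁⟩ := h₁
  obtain ⟨C₂, hC₂, h₂⟩ := h₂
  refine ⟨C₁ + C₂, by positivity, fun f S S' hS hS' => ?_⟩
  rw [← Finset.sum_filter_add_sum_filter_not S' (· ∈ Y₁), add_mul]
  refine add_le_add (h₁ f S _ hS fun n hn => ?_) (h₂ f S _ hS fun n hn => ?_)
  · exact (Finset.mem_filter.1 hn).2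
  · have h := Finset.mem_filter.1 hn
    exact (hS' h.1).resolve_left h.2

theorem BlockBound.union_left (h₁ : BlockBound c u v X₁ Y) (h₂ : BlockBound c u v X₂ Y) :
    BlockBound c u v (X₁ ∪ X₂) Y := by
  classical
  obtain ⟨C₁, hC₁, h₁⟩ := h₁
  obtain ⟨C₂, hC₂, h₂⟩ := h₂
  -- The factor `2` comes from `‖a + b‖ ^ 2 ≤ 2 (‖a‖ ^ 2 + ‖b‖ ^ 2)`.
  refine ⟨2 * (C₁ + C₂), by positivity, fun f S S' hS hS' => ?_⟩
  set S₁ := S.filter (· ∈ X₁) with hS₁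
  set S₂ := S.filter (· ∉ X₁) with hS₂
  have hX₁ : (S₁ : Set ι) ⊆ X₁ := fun m hm => (Finset.mem_filter.1 hm).2
  have hX₂ : (S₂ : Set ι) ⊆ X₂ := fun m hm => by
    have h := Finset.mem_filter.1 hm
    exact (hS h.1).resolve_left h.2
  have e₁ := h₁ f S₁ S' hX₁ hS'
  have e₂ := h₂ f S₂ S' hX₂ hS'
  have hsplit : ∑ m ∈ S, ‖f m‖ ^ 2 * u m ^ 2 =
      ∑ m ∈ S₁, ‖f m‖ ^ 2 * u m ^ 2 + ∑ m ∈ S₂, ‖f m‖ ^ 2 * u m ^ 2 :=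
    (Finset.sum_filter_add_sum_filter_not S (· ∈ X₁) _).symm
  have p₁ : 0 ≤ ∑ m ∈ S₁, ‖f m‖ ^ 2 * u m ^ 2 := by positivity
  have p₂ : 0 ≤ ∑ m ∈ S₂, ‖f m‖ ^ 2 * u m ^ 2 := by positivity
  have hle : ∑ n ∈ S', ‖∑ m ∈ S, f m * c m n‖ ^ 2 * v n ^ 2 ≤
      2 * (∑ n ∈ S', ‖∑ m ∈ S₁, f m * c m n‖ ^ 2 * v n ^ 2 +
        ∑ n ∈ S', ‖∑ m ∈ S₂, f m * c m n‖ ^ 2 * v n ^ 2) := by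
    rw [← Finset.sum_add_distrib, Finset.mul_sum]
    refine Finset.sum_le_sum fun n _ => ?_
    rw [← Finset.sum_filter_add_sum_filter_not S (· ∈ X₁), ← add_mul, ← mul_assoc]
    refine mul_le_mul_of_nonneg_right ?_ (sq_nonneg _)
    refine (pow_le_pow_left₀ (norm_nonneg _) (norm_add_le _ _) 2).trans ?_
    nlinarith [sq_nonneg (‖∑ m ∈ S₁, f m * c m n‖ - ‖∑ m ∈ S₂, f m * c m n‖)]
  rw [hsplit]
  nlinarith [mul_nonneg hC₁ p₂, mul_nonneg hC₂ p₁]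

/-- Boundedness of a matrix follows from boundedness of the transposed matrix between the dual
spaces. -/
theorem BlockBound.of_transpose (hu : ∀ m, 0 < u m) (hv : ∀ n, 0 < v n)
    (h : BlockBound (fun n m => c m n) (fun n => (v n)⁻¹) (fun m => (u m)⁻¹) Y X) :
    BlockBound c u v X Y := by
  obtain ⟨C, hC, h⟩ := h
  refine ⟨C, hC, fun f S S' hS hS' => ?_⟩
  set g : κ → ℂ := fun n => ∑ m ∈ S, f m * c m n with hg
  set N : ℝ := ∑ n ∈ S', ‖g n‖ ^ 2 * v n ^ 2 with hN
  set Q : ℝ := ∑ m ∈ S, ‖f m‖ ^ 2 * u m ^ 2 with hQ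
  have hN0 : 0 ≤ N := by positivity
  have hQ0 : 0 ≤ Q := by positivity
  -- The dual vector that norms `g`. Pairing it with `g` gives `N`, and Cauchy-Schwarz with the
  -- transposed bound gives `N ^ 2 ≤ Q C N`.
  let b : κ → ℂ := fun n => conj (g n) * (v n ^ 2 : ℝ)
  have h1 := h b S' S hS' hS
  have h2 : ∑ n ∈ S', ‖b n‖ ^ 2 * (v n)⁻¹ ^ 2 = N := by
    refine Finset.sum_congr rfl fun n _ => ?_
    have := (hv n).ne'
    simp only [b, norm_mul, Complex.norm_conj, Complex.norm_real, Real.norm_eq_abs, abs_pow,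
      sq_abs]
    field_simp
  have h3 : (N : ℂ) = ∑ m ∈ S, f m * ∑ n ∈ S', b n * c m n := by
    simp_rw [Finset.mul_sum]
    rw [Finset.sum_comm, hN, Complex.ofReal_sum]
    refine Finset.sum_congr rfl fun n _ => ?_
    have h4 : ∀ m, f m * (b n * c m n) = b n * (f m * c m n) := fun m => by ring
    simp_rw [h4]
    rw [← Finset.mul_sum]
    change _ = conj (g n) * _ * g n
    rw [mul_right_comm, Complex.conj_mul']
    push_cast
    ring
  have h5 : N ^ 2 ≤ Q * (C * N) := by
    have h6 : N ≤ ∑ m ∈ S, (‖f m‖ * u m) * (‖∑ n ∈ S', b n * c m n‖ * (u m)⁻¹) := by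
      have h7 : N = ‖(N : ℂ)‖ := by simp [abs_of_nonneg hN0]
      rw [h7, h3]
      refine (norm_sum_le _ _).trans (Finset.sum_le_sum fun m _ => ?_)
      have := (hu m).ne'
      rw [norm_mul]
      refine le_of_eq ?_
      field_simp
    refine (pow_le_pow_left₀ hN0 h6 2).trans ((Finset.sum_mul_sq_le_sq_mul_sq _ _ _).trans ?_)
    simp only [mul_pow]
    exact mul_le_mul_of_nonneg_left (h1.trans_eq (by rw [h2])) hQ0
  rcases hN0.eq_or_lt with h8 | h8
  · rw [← h8]; positivity
  · refine le_of_mul_le_mul_right ?_ h8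
    nlinarith

/-- Transposing a Fourier matrix under a change of variables replaces `(m, n)` by `(-n, -m)`; this
absorbs the signs. -/
theorem BlockBound.comp_neg [AddGroup ι] [AddGroup κ] (h : BlockBound c u v X Y) :
    BlockBound (fun m n => c (-m) (-n)) (fun m => u (-m)) (fun n => v (-n)) (-X) (-Y) := by
  classical
  obtain ⟨C, hC, h⟩ := h
  refine ⟨C, hC, fun f S S' hS hS' => ?_⟩
  have h1 := h (fun m => f (-m)) (S.map (Equiv.neg ι).toEmbedding)
    (S'.map (Equiv.neg κ).toEmbedding) ?_ ?_
  · simpa using h1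
  · intro m hm
    obtain ⟨m', hm', rfl⟩ := Finset.mem_map.1 hm
    exact hS hm'
  · intro m hm
    obtain ⟨m', hm', rfl⟩ := Finset.mem_map.1 hm
    exact hS' hm'

end BlockBound

/-! ### Exponents and quadrants -/

/-- The exponent `n` in the coordinates `k = Pᵀ n`. -/
def dualVec (P : Matrix.GeneralLinearGroup (Fin 2) ℝ) (n : Fin 2 → ℤ) : Fin 2 → ℝ :=
  P.1.transpose.mulVec fun i => (n i : ℝ)

/-- The exponents `n` for which `Pᵀ n` lies in the closed quadrant with signs `τ`. -/
def quadrant (P : Matrix.GeneralLinearGroup (Fin 2) ℝ) (τ : Fin 2 → ℤˣ) : Set (Fin 2 → ℤ) :=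
  {n | ∀ i, dualVec P n i = sgn (τ i) * |dualVec P n i|}

/-- The weight `exp (-⟨a, |Pᵀ n|⟩)`. -/
def expWeight (P : Matrix.GeneralLinearGroup (Fin 2) ℝ) (a : Fin 2 → ℝ) (n : Fin 2 → ℤ) : ℝ :=
  Real.exp (-∑ i, a i * |dualVec P n i|)

variable {P : Matrix.GeneralLinearGroup (Fin 2) ℝ}

theorem dualVec_neg (n : Fin 2 → ℤ) : dualVec P (-n) = -dualVec P n := by
  rw [dualVec, dualVec, ← Matrix.mulVec_neg]
  congr 1
  ext i
  simp

theorem expWeight_neg (a : Fin 2 → ℝ) (n : Fin 2 → ℤ) : expWeight P a (-n) = expWeight P a n := by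
  simp [expWeight, dualVec_neg]

theorem sgn_neg (s : ℤˣ) : sgn (-s) = -sgn s := by simp [sgn]

theorem abs_sgn (s : ℤˣ) : |sgn s| = 1 := by
  rcases Int.units_eq_one_or s with rfl | rfl <;> simp [sgn]

theorem neg_quadrant (τ : Fin 2 → ℤˣ) : -quadrant P τ = quadrant P (-τ) := by
  ext n
  simp only [Set.mem_neg, quadrant, mem_ofPred_eq, dualVec_neg, Pi.neg_apply, abs_neg, sgn_neg]
  refine forall_congr' fun i => ?_
  rw [neg_mul, neg_eq_iff_eq_neg]

theorem sum_mul_mulVec (n : Fin 2 → ℤ) (y : Fin 2 → ℝ) :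
    ∑ i, (n i : ℝ) * P.1.mulVec y i = ∑ i, dualVec P n i * y i := by
  have h := Matrix.dotProduct_mulVec (fun i => (n i : ℝ)) P.1 y
  rw [← Matrix.mulVec_transpose] at h
  exact h

theorem inv_mulVec_mulVec (y : Fin 2 → ℝ) : (P⁻¹).1.mulVec (P.1.mulVec y) = y := by
  rw [Matrix.mulVec_mulVec, ← Units.val_mul, inv_mul_cancel, Units.val_one, Matrix.one_mulVec]

theorem mulVec_inv_mulVec (y : Fin 2 → ℝ) : P.1.mulVec ((P⁻¹).1.mulVec y) = y := by
  rw [Matrix.mulVec_mulVec, ← Units.val_mul, mul_inv_cancel, Units.val_one, Matrix.one_mulVec]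

theorem summable_exp_neg_abs {c : ℝ} (hc : 0 < c) :
    Summable fun n : ℤ => Real.exp (-(c * |(n : ℝ)|)) := by
  have h : Summable fun n : ℕ => Real.exp (-(c * |((n : ℤ) : ℝ)|)) := by
    have := Real.summable_exp_nat_mul_iff.2 (neg_lt_zero.2 hc)
    refine this.congr fun n => ?_
    congr 1
    simp
    ring
  refine Summable.of_nat_of_neg h (h.congr fun n => ?_)
  simp

/-- `Pᵀ` is invertible, so `n` is recovered from `Pᵀ n` with entries of `P⁻¹` as coefficients. -/
theorem exists_mul_abs_le_dualVec (P : Matrix.GeneralLinearGroup (Fin 2) ℝ) :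
    ∃ c : ℝ, 0 < c ∧ ∀ n : Fin 2 → ℤ, c * ∑ i, |(n i : ℝ)| ≤ ∑ i, |dualVec P n i| := by
  set B : ℝ := ∑ i, ∑ j, |(P⁻¹).1 i j| + 1 with hB
  have hB0 : 0 < B := by positivity
  refine ⟨(2 * B)⁻¹, by positivity, fun n => ?_⟩
  have h1 : ∀ i, |(n i : ℝ)| ≤ B * ∑ j, |dualVec P n j| := by
    intro i
    have h2 : (n i : ℝ) = ∑ j, dualVec P n j * (P⁻¹).1 j i := by
      have h3 := sum_mul_mulVec (P := P) n ((P⁻¹).1.mulVec (Pi.single i 1))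
      rw [mulVec_inv_mulVec] at h3
      simpa [Pi.single_apply] using h3
    rw [h2, Finset.mul_sum]
    refine (Finset.abs_sum_le_sum_abs _ _).trans (Finset.sum_le_sum fun j _ => ?_)
    rw [abs_mul, mul_comm]
    refine mul_le_mul_of_nonneg_right ?_ (abs_nonneg _)
    have h4 : |(P⁻¹).1 j i| ≤ ∑ i, |(P⁻¹).1 j i| :=
      Finset.single_le_sum (f := fun i => |(P⁻¹).1 j i|) (fun _ _ => abs_nonneg _)
        (Finset.mem_univ i)
    have h5 : ∑ i, |(P⁻¹).1 j i| ≤ ∑ j, ∑ i, |(P⁻¹).1 j i| :=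
      Finset.single_le_sum (f := fun j => ∑ i, |(P⁻¹).1 j i|)
        (fun _ _ => Finset.sum_nonneg fun _ _ => abs_nonneg _) (Finset.mem_univ j)
    linarith
  rw [inv_mul_le_iff₀ (by positivity), Fin.sum_univ_two]
  linarith [h1 0, h1 1]

theorem summable_exp_neg_dualVec (P : Matrix.GeneralLinearGroup (Fin 2) ℝ) {ε : ℝ} (hε : 0 < ε) :
    Summable fun n : Fin 2 → ℤ => Real.exp (-(ε * ∑ i, |dualVec P n i|)) := by
  obtain ⟨c, hc, h⟩ := exists_mul_abs_le_dualVec P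
  have h1 := summable_exp_neg_abs (mul_pos hε hc)
  have h2 := h1.mul_of_nonneg h1 (fun _ => (Real.exp_pos _).le) fun _ => (Real.exp_pos _).le
  refine Summable.of_nonneg_of_le (fun _ => (Real.exp_pos _).le) (fun n => ?_)
    ((finTwoArrowEquiv ℤ).summable_iff.2 h2)
  change _ ≤ Real.exp (-(ε * c * |(n 0 : ℝ)|)) * Real.exp (-(ε * c * |(n 1 : ℝ)|))
  rw [← Real.exp_add, Real.exp_le_exp]
  have := mul_le_mul_of_nonneg_left (h n) hε.le
  rw [Fin.sum_univ_two] at this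
  linarith

theorem norm_prod_zpow_eq {w : Fin 2 → ℂ} (hw : ∀ i, w i ≠ 0) {y : Fin 2 → ℝ}
    (hy : P.1.mulVec y = logAbs w) (n : Fin 2 → ℤ) :
    ‖∏ i, w i ^ n i‖ = Real.exp (∑ i, dualVec P n i * y i) := by
  rw [← sum_mul_mulVec, hy, Real.exp_sum, norm_prod]
  refine Finset.prod_congr rfl fun i _ => ?_
  rw [norm_zpow, logAbs, mul_comm, ← Real.rpow_def_of_pos (norm_pos_iff.2 (hw i)),
    Real.rpow_intCast]

/-- Point evaluations on compact subsets of `domain P A τ` are uniformly bounded on Laurent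
polynomials with exponents in the opposite quadrant. -/
theorem exists_eval_bound {A : Fin 2 → ℝ} {τ : Fin 2 → ℤˣ} {K : Set (Fin 2 → ℂ)} (hK : IsCompact K)
    (hKD : K ⊆ domain P A τ) :
    ∃ C : ℝ, 0 ≤ C ∧ ∀ (f : (Fin 2 → ℤ) → ℂ) (S : Finset (Fin 2 → ℤ)), ↑S ⊆ quadrant P (-τ) →
      ∀ w ∈ K, ‖∑ m ∈ S, f m * ∏ i, w i ^ m i‖ ^ 2 ≤
        C * ∑ m ∈ S, ‖f m‖ ^ 2 * expWeight P A m ^ 2 := by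
  have hlog : ContinuousOn logAbs K := by
    refine continuousOn_pi.2 fun i => ?_
    refine ContinuousOn.log (by fun_prop) fun w hw => ?_
    exact norm_ne_zero_iff.2 ((hKD hw).1 i)
  have hy : ∀ i, ContinuousOn (fun w => sgn (τ i) * (P⁻¹).1.mulVec (logAbs w) i) K := by
    intro i
    refine continuousOn_const.mul ?_
    exact (Continuous.comp_continuousOn (by fun_prop : Continuous fun x => (P⁻¹).1.mulVec x i) hlog)
  have hmem : ∀ w ∈ K, ∀ i, A i < sgn (τ i) * (P⁻¹).1.mulVec (logAbs w) i := by
    intro w hw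
    obtain ⟨y, hy, hyw⟩ := (hKD hw).2
    simp only at hyw
    rw [← hyw, inv_mulVec_mulVec]
    exact hy
  -- Compactness turns the strict inequalities of the cone into a uniform gap `ε`, whose factor `exp
  -- (-ε |k|)` is square summable.
  obtain ⟨ε, hε, hεK⟩ : ∃ ε : ℝ, 0 < ε ∧ ∀ w ∈ K, ∀ i,
      A i + ε ≤ sgn (τ i) * (P⁻¹).1.mulVec (logAbs w) i := by
    choose b hb hbK using fun i => hK.exists_forall_le' (hy i) fun w hw => hmem w hw i
    refine ⟨min (b 0 - A 0) (b 1 - A 1), lt_min (sub_pos.2 (hb 0)) (sub_pos.2 (hb 1)),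
      fun w hw i => ?_⟩
    refine le_trans ?_ (hbK i w hw)
    have h0 := min_le_left (b 0 - A 0) (b 1 - A 1)
    have h1 := min_le_right (b 0 - A 0) (b 1 - A 1)
    revert i
    refine Fin.forall_fin_two.2 ⟨?_, ?_⟩ <;> linarith
  have hsum := summable_exp_neg_dualVec P (mul_pos two_pos hε)
  refine ⟨∑' n, Real.exp (-(2 * ε * ∑ i, |dualVec P n i|)),
    tsum_nonneg fun _ => (Real.exp_pos _).le, fun f S hS w hw => ?_⟩
  have h1 : ∀ m ∈ S, ‖f m * ∏ i, w i ^ m i‖ ≤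
      Real.exp (-(ε * ∑ i, |dualVec P m i|)) * (‖f m‖ * expWeight P A m) := by
    intro m hm
    rw [norm_mul, norm_prod_zpow_eq (hKD hw).1 (mulVec_inv_mulVec _), mul_left_comm, expWeight,
      ← Real.exp_add]
    refine mul_le_mul_of_nonneg_left (Real.exp_le_exp.2 ?_) (norm_nonneg _)
    rw [Finset.mul_sum, ← neg_add, ← Finset.sum_add_distrib, ← Finset.sum_neg_distrib]
    refine Finset.sum_le_sum fun i _ => ?_
    have h2 : dualVec P m i = -sgn (τ i) * |dualVec P m i| := by
      simpa [sgn_neg] using hS hm i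
    have h3 := mul_le_mul_of_nonneg_left (hεK w hw i) (abs_nonneg (dualVec P m i))
    calc dualVec P m i * (P⁻¹).1.mulVec (logAbs w) i
        = -(|dualVec P m i| * (sgn (τ i) * (P⁻¹).1.mulVec (logAbs w) i)) := by
          conv_lhs => rw [h2]
          ring
      _ ≤ _ := by linarith
  have h2 : ‖∑ m ∈ S, f m * ∏ i, w i ^ m i‖ ≤
      ∑ m ∈ S, Real.exp (-(ε * ∑ i, |dualVec P m i|)) * (‖f m‖ * expWeight P A m) :=
    (norm_sum_le _ _).trans (Finset.sum_le_sum h1)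
  refine (pow_le_pow_left₀ (norm_nonneg _) h2 2).trans
    ((Finset.sum_mul_sq_le_sq_mul_sq _ _ _).trans ?_)
  simp only [mul_pow]
  refine mul_le_mul_of_nonneg_right ?_ (by positivity)
  refine le_trans (le_of_eq ?_) (hsum.sum_le_tsum S fun _ _ => (Real.exp_pos _).le)
  refine Finset.sum_congr rfl fun m _ => ?_
  rw [← Real.exp_nat_mul]
  congr 1
  push_cast
  ring

end Quadrants

/-! ### The matrix of the composition operator, directly and by duality -/

section CompositionMatrix

theorem continuous_toC2 : Continuous toC2 :=
  continuous_pi fun i => continuous_subtype_val.comp (continuous_apply i)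

theorem continuous_torus_toCircle :
    Continuous fun (θ : UnitAddTorus (Fin 2)) (i : Fin 2) => (θ i).toCircle :=
  continuous_pi fun i => AddCircle.continuous_toCircle.comp (continuous_apply i)

theorem fourierCoefficient_sum {ι : Type*} (S : Finset ι) (f : ι → ℂ)
    {g : ι → (Fin 2 → Circle) → ℂ} (hg : ∀ m ∈ S, Continuous (g m)) (n : Fin 2 → ℤ) :
    fourierCoefficient (fun z => ∑ m ∈ S, f m * g m z) n =
      ∑ m ∈ S, f m * fourierCoefficient (g m) n := by
  simp only [fourierCoefficient, UnitAddTorus.mFourierCoeff, smul_eq_mul, Finset.mul_sum]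
  rw [integral_finsetSum]
  · refine Finset.sum_congr rfl fun m _ => ?_
    rw [← integral_const_mul]
    exact integral_congr_ae (Eventually.of_forall fun θ => by ring)
  · intro m hm
    refine Continuous.integrable_of_hasCompactSupport ?_ (HasCompactSupport.of_compactSpace _)
    exact (ContinuousMap.continuous _).mul
      (continuous_const.mul ((hg m hm).comp continuous_torus_toCircle))

theorem toC2_mem_slab (v : Fin 2 → ℝ) (z : Fin 2 → Circle) : toC2 z ∈ slab v :=
  ⟨0, by simp, fun i => by simpa using! Circle.norm_coe (z i)⟩

theorem isCompact_polyTorus (ρ : Fin 2 → ℝ) : IsCompact (polyTorus ρ) := by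
  have h : polyTorus ρ = univ.pi fun i => sphere (0 : ℂ) (ρ i) := by
    ext z; simp [polyTorus]
  rw [h]
  exact isCompact_univ_pi fun i => isCompact_sphere _ _

theorem polyTorus_exp_subset_slab (v : Fin 2 → ℝ) :
    (polyTorus fun i => Real.exp (v i)) ⊆ slab v :=
  fun z hz => ⟨1, by simp, fun i => by rw [one_mul]; exact hz i⟩

variable {P : Matrix.GeneralLinearGroup (Fin 2) ℝ}

/-- A composition operator, with a holomorphic multiplier `J`, is bounded from functions with
exponents in a quadrant to functions on the torus `{|z| = exp v}` if the map sends this torus into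
the domain of the opposite signs. -/
theorem blockBound_of_mapsTo {T : (Fin 2 → Circle) → (Fin 2 → Circle)}
    {F : (Fin 2 → ℂ) → (Fin 2 → ℂ)} {J : (Fin 2 → ℂ) → ℂ} {U : Set (Fin 2 → ℂ)} (hU : IsOpen U)
    {v : Fin 2 → ℝ} (hv : slab v ⊆ U) (hF : DifferentiableOn ℂ F U) (hJ : DifferentiableOn ℂ J U)
    (hF0 : ∀ z ∈ U, ∀ i, F z i ≠ 0) (hFT : ∀ z, F (toC2 z) = toC2 (T z))
    {A : Fin 2 → ℝ} {τ : Fin 2 → ℤˣ}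
    (hmaps : MapsTo F (polyTorus fun i => Real.exp (v i)) (domain P A τ)) :
    BlockBound (fun m n => fourierCoefficient (fun z => J (toC2 z) * ∏ i, (T z i : ℂ) ^ m i) n)
      (expWeight P A) (fun n => Real.exp (∑ i, n i * v i)) (quadrant P (-τ)) univ := by
  have hsub := polyTorus_exp_subset_slab v
  have hK := isCompact_polyTorus fun i => Real.exp (v i)
  have hFi : ∀ i, DifferentiableOn ℂ (fun z => F z i) U := differentiableOn_pi.1 hF
  obtain ⟨C, hC, hbound⟩ := exists_eval_bound
    (hK.image_of_continuousOn (hF.continuousOn.mono (hsub.trans hv))) hmaps.image_subset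
  obtain ⟨B, hB⟩ := hK.exists_bound_of_continuousOn (hJ.continuousOn.mono (hsub.trans hv))
  have hmon : ∀ m : Fin 2 → ℤ, DifferentiableOn ℂ (fun z => J z * ∏ i, F z i ^ m i) U := by
    intro m
    have h : ∀ i, DifferentiableOn ℂ (fun z => F z i ^ m i) U := fun i z hz =>
      DifferentiableAt.comp_differentiableWithinAt (g := fun w : ℂ => w ^ m i) z
        (differentiableAt_zpow.2 (Or.inl (hF0 z hz i))) (hFi i z hz)
    simp only [Fin.prod_univ_two]
    exact hJ.mul ((h 0).mul (h 1))
  refine ⟨B ^ 2 * C, by positivity, fun f S S' hS _ => ?_⟩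
  set N : ℝ := ∑ m ∈ S, ‖f m‖ ^ 2 * expWeight P A m ^ 2 with hN
  have hN0 : 0 ≤ N := by positivity
  let Φ : (Fin 2 → ℂ) → ℂ := fun z => ∑ m ∈ S, f m * (J z * ∏ i, F z i ^ m i)
  have hΦ : DifferentiableOn ℂ Φ U :=
    DifferentiableOn.fun_sum fun m _ => (hmon m).const_mul (f m)
  have hM : ∀ z ∈ polyTorus fun i => Real.exp (v i), ‖Φ z‖ ≤ Real.sqrt (B ^ 2 * C * N) := by
    intro z hz
    refine Real.le_sqrt_of_sq_le ?_
    have h1 : Φ z = J z * ∑ m ∈ S, f m * ∏ i, F z i ^ m i := by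
      rw [Finset.mul_sum]
      exact Finset.sum_congr rfl fun m _ => by ring
    rw [h1, norm_mul, mul_pow, mul_assoc]
    exact mul_le_mul (pow_le_pow_left₀ (norm_nonneg _) (hB z hz) 2)
      (hbound f S hS _ (mem_image_of_mem F hz)) (by positivity) (by positivity)
  have h1 := laurentCoeff_sq_sum_le hU hv hΦ hM S'
  rw [Real.sq_sqrt (by positivity)] at h1
  refine le_trans (le_of_eq ?_) h1
  refine Finset.sum_congr rfl fun n _ => ?_
  congr 3
  rw [← fourierCoefficient_sum]
  · simp only [fourierCoefficient, Φ, hFT, toC2]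
  · intro m _
    have h2 := (hmon m).continuousOn.comp_continuous continuous_toC2
      fun z => hv (toC2_mem_slab v z)
    refine h2.congr fun z => ?_
    simp only [Function.comp_apply, hFT]
    rfl

/-- The matrix of the composition operator `f ↦ f ∘ T` with respect to the monomials. -/
def compMatrix (T : (Fin 2 → Circle) → (Fin 2 → Circle)) (m n : Fin 2 → ℤ) : ℂ :=
  fourierCoefficient (fun z => ∏ i, (T z i : ℂ) ^ m i) n

theorem slab_subset_ne_zero {T : (Fin 2 → Circle) → (Fin 2 → Circle)}
    {F : (Fin 2 → ℂ) → (Fin 2 → ℂ)} {U : Set (Fin 2 → ℂ)} (hU : IsOpen U)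
    {v : Fin 2 → ℝ} (hv : slab v ⊆ U) (hF : DifferentiableOn ℂ F U)
    (hFT : ∀ z, F (toC2 z) = toC2 (T z)) : slab v ⊆ U ∩ {z | ∀ i, F z i ≠ 0} := by
  refine subset_inter hv fun z hz i => ?_
  exact ne_zero_of_norm_eq_one hU hv (differentiableOn_pi.1 hF i)
    (fun z => by rw [hFT]; exact Circle.norm_coe _) hz

theorem blockBound_compMatrix {T : (Fin 2 → Circle) → (Fin 2 → Circle)}
    {F : (Fin 2 → ℂ) → (Fin 2 → ℂ)} {U : Set (Fin 2 → ℂ)} (hU : IsOpen U)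
    {v : Fin 2 → ℝ} (hv : slab v ⊆ U) (hF : DifferentiableOn ℂ F U)
    (hFT : ∀ z, F (toC2 z) = toC2 (T z)) {A : Fin 2 → ℝ} {τ : Fin 2 → ℤˣ}
    (hmaps : MapsTo F (polyTorus fun i => Real.exp (v i)) (domain P A τ)) :
    BlockBound (compMatrix T) (expWeight P A) (fun n => Real.exp (∑ i, n i * v i))
      (quadrant P (-τ)) univ := by
  have h := blockBound_of_mapsTo (J := fun _ => 1) (isOpen_inter_ne_zero hU hF.continuousOn)
    (slab_subset_ne_zero hU hv hF hFT) (hF.mono inter_subset_left) (by fun_prop)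
    (fun z hz => hz.2) hFT hmaps
  simp only [one_mul] at h
  exact h

/-- Change of variables for the matrix of the composition operator. -/
theorem exists_compMatrix_eq (T : (Fin 2 → Circle) ≃ (Fin 2 → Circle))
    {F G : (Fin 2 → ℂ) → (Fin 2 → ℂ)} {U V : Set (Fin 2 → ℂ)} (hU : IsOpen U) (hV : IsOpen V)
    (hFU : DifferentiableOn ℂ F U) (hGV : DifferentiableOn ℂ G V)
    (hUT : ∀ z, toC2 z ∈ U) (hVT : ∀ z, toC2 z ∈ V) (hF : ∀ z, F (toC2 z) = toC2 (T z))
    (hG : ∀ z, G (toC2 z) = toC2 (T.symm z)) :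
    ∃ ε : ℂ, ‖ε‖ = 1 ∧ ∀ m n, compMatrix T m n = fourierCoefficient (fun z =>
      ε * (logJacobian G (toC2 z)).det * ∏ i, (T.symm z i : ℂ) ^ (-n) i) (-m) := by
  obtain ⟨ε, hε, h⟩ := integral_torus_comp_eq T hU hV hFU hGV hUT hVT hF hG
  have hmon : ∀ (k : Fin 2 → ℤ) (θ : UnitAddTorus (Fin 2)),
      UnitAddTorus.mFourier k θ = ∏ i, ((θ i).toCircle : ℂ) ^ k i := fun k θ => by
    simp [UnitAddTorus.mFourier, fourier_apply, AddCircle.toCircle_zsmul]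
  refine ⟨ε, hε, fun m n => ?_⟩
  -- Substituting `T⁻¹` turns `T ^ m` into the monomial `z ^ m` and `z ^ (-n)` into `(T⁻¹) ^ (-n)`.
  have h1 := h fun z => (∏ i, (z i : ℂ) ^ (-n) i) * ∏ i, (T z i : ℂ) ^ m i
  simp only [T.apply_symm_apply] at h1
  simp only [compMatrix, fourierCoefficient, UnitAddTorus.mFourierCoeff, smul_eq_mul, hmon,
    neg_neg]
  refine h1.trans (integral_congr_ae (Eventually.of_forall fun θ => ?_))
  simp only
  ring

/-- Duality: the matrix of `f ↦ f ∘ T` is estimated through the inverse map. -/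
theorem blockBound_compMatrix_of_inverse (T : (Fin 2 → Circle) ≃ (Fin 2 → Circle))
    {F G : (Fin 2 → ℂ) → (Fin 2 → ℂ)} {U V : Set (Fin 2 → ℂ)} (hU : IsOpen U) (hV : IsOpen V)
    (hFU : DifferentiableOn ℂ F U) (hGV : DifferentiableOn ℂ G V)
    (hUT : ∀ z, toC2 z ∈ U) (hF : ∀ z, F (toC2 z) = toC2 (T z))
    (hG : ∀ z, G (toC2 z) = toC2 (T.symm z)) {v : Fin 2 → ℝ} (hv : slab v ⊆ V) {γ : Fin 2 → ℝ}
    {τ : Fin 2 → ℤˣ}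
    (hmaps : MapsTo G (polyTorus fun i => Real.exp (v i)) (domain P γ τ)) :
    BlockBound (compMatrix T) (fun m => Real.exp (∑ i, m i * v i)) (expWeight P (-γ)) univ
      (quadrant P τ) := by
  have hVT : ∀ z, toC2 z ∈ V := fun z => hv (toC2_mem_slab v z)
  have hV0 := isOpen_inter_ne_zero hV hGV.continuousOn
  obtain ⟨ε, hε, hT⟩ := exists_compMatrix_eq T hU hV hFU hGV hUT hVT hF hG
  have hGV0 : DifferentiableOn ℂ G (V ∩ {z | ∀ i, G z i ≠ 0}) := hGV.mono inter_subset_left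
  have h := blockBound_of_mapsTo (J := fun z => ε * (logJacobian G z).det) hV0
    (slab_subset_ne_zero hV hv hGV hG) hGV0
    ((differentiableOn_det_logJacobian hV0 hGV0 fun z hz => hz.2).const_mul ε)
    (fun z hz => hz.2) hG hmaps
  -- Inverting the weights exchanges `γ` and `-γ`, as well as `exp (m ⬝ v)` and `exp (-m ⬝ v)`.
  refine BlockBound.of_transpose (fun _ => Real.exp_pos _) (fun _ => Real.exp_pos _) ?_
  have h2 := h.comp_neg
  rw [neg_quadrant, neg_neg, Set.neg_univ] at h2
  simp only [hT]
  refine h2.mono subset_rfl subset_rfl (fun n _ => ?_) fun m _ => ?_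
  · rw [expWeight_neg, expWeight, expWeight, ← Real.exp_neg]
    simp
  · rw [← Real.exp_neg]
    simp

end CompositionMatrix

/-! ### Tori and weights in logarithmic coordinates; the four blocks -/

section Geometry

theorem BlockBound.biUnion_left {ι κ σ : Type*} {c : ι → κ → ℂ} {u : ι → ℝ} {v : κ → ℝ}
    {X : σ → Set ι} {Y : Set κ} {I : Set σ} (hI : I.Finite)
    (h : ∀ τ ∈ I, BlockBound c u v (X τ) Y) : BlockBound c u v (⋃ τ ∈ I, X τ) Y := by
  induction I, hI using Set.Finite.induction_on with
  | empty =>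
    refine ⟨0, le_rfl, fun f S S' hS _ => ?_⟩
    have hS' : S = ∅ := by simpa using hS
    simp [hS']
  | insert _ _ ih =>
    rw [biUnion_insert]
    exact (h _ (mem_insert _ _)).union_left (ih fun τ hτ => h τ (mem_insert_of_mem _ hτ))

theorem BlockBound.biUnion_right {ι κ σ : Type*} {c : ι → κ → ℂ} {u : ι → ℝ} {v : κ → ℝ}
    {X : Set ι} {Y : σ → Set κ} {I : Set σ} (hI : I.Finite)
    (h : ∀ τ ∈ I, BlockBound c u v X (Y τ)) : BlockBound c u v X (⋃ τ ∈ I, Y τ) := by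
  induction I, hI using Set.Finite.induction_on with
  | empty =>
    refine ⟨0, le_rfl, fun f S S' _ hS => ?_⟩
    have hS' : S' = ∅ := by simpa using hS
    simp [hS']
  | insert _ _ ih =>
    rw [biUnion_insert]
    exact (h _ (mem_insert _ _)).union_right (ih fun τ hτ => h τ (mem_insert_of_mem _ hτ))

variable {P : Matrix.GeneralLinearGroup (Fin 2) ℝ}

theorem neg_mem_signs {l : ℤˣ} {σ : Fin 2 → ℤˣ} (h : σ ∈ signs l) : -σ ∈ signs l := by
  have h' : σ 0 * σ 1 = l := h
  change -σ 0 * -σ 1 = l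
  rw [neg_mul_neg, h']

/-- Since the sign set is closed under negation, both alternatives reach every target domain, which
is all that the estimates need. -/
theorem StronglyExpanding.exists_mapsTo {l : ℤˣ} {δ Δ : Fin 2 → ℝ}
    {F : (Fin 2 → ℂ) → (Fin 2 → ℂ)} (h : StronglyExpanding l δ Δ P F) {τ : Fin 2 → ℤˣ}
    (hτ : τ ∈ signs l) :
    ∃ σ ∈ signs l, MapsTo F (shilovTorus P δ σ) (domain P Δ τ) := by
  rcases h.2 with h | h
  · exact ⟨τ, hτ, (h τ hτ).1⟩
  · refine ⟨-τ, neg_mem_signs hτ, ?_⟩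
    have := (h (-τ) (neg_mem_signs hτ)).1
    rwa [neg_neg] at this

theorem isOpen_annulus (δ : Fin 2 → ℝ) : IsOpen (annulus P δ) := by
  have hne : IsOpen {z : Fin 2 → ℂ | ∀ i, z i ≠ 0} := by
    simp only [ofPred_forall]
    exact isOpen_iInter_of_finite fun i => isOpen_ne.preimage (continuous_apply i)
  have hlog : ContinuousOn logAbs {z : Fin 2 → ℂ | ∀ i, z i ≠ 0} :=
    continuousOn_pi.2 fun i => ContinuousOn.log (by fun_prop) fun w hw => norm_ne_zero_iff.2 (hw i)
  have ho : IsOpen {x : Fin 2 → ℝ | ∀ i, |(P⁻¹).1.mulVec x i| < |δ i|} := by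
    simp only [ofPred_forall]
    exact isOpen_iInter_of_finite fun i => isOpen_lt (by fun_prop) continuous_const
  exact hlog.isOpen_inter_preimage hne ho

theorem mem_annulus_of_norm_eq {δ v : Fin 2 → ℝ} {z : Fin 2 → ℂ}
    (hz : ∀ i, ‖z i‖ = Real.exp (v i)) (hv : ∀ i, |(P⁻¹).1.mulVec v i| < |δ i|) :
    z ∈ annulus P δ := by
  have hlog : logAbs z = v := funext fun i => by rw [logAbs, hz, Real.log_exp]
  refine ⟨fun i => ?_, by rwa [hlog]⟩
  rw [← norm_pos_iff, hz]
  exact Real.exp_pos _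

theorem abs_mulVec_smul_lt {δ v : Fin 2 → ℝ} (hv : ∀ i, |(P⁻¹).1.mulVec v i| < |δ i|) {t : ℝ}
    (ht : |t| ≤ 1) (i : Fin 2) : |(P⁻¹).1.mulVec (fun i => t * v i) i| < |δ i| := by
  have h : (fun i => t * v i) = t • v := rfl
  rw [h, Matrix.mulVec_smul, Pi.smul_apply, smul_eq_mul, abs_mul]
  exact (mul_le_of_le_one_left (abs_nonneg _) ht).trans_lt (hv i)

theorem slab_subset_annulus {δ v : Fin 2 → ℝ} (hv : ∀ i, |(P⁻¹).1.mulVec v i| < |δ i|) :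
    slab v ⊆ annulus P δ := by
  rintro z ⟨t, ht, hz⟩
  exact mem_annulus_of_norm_eq hz (abs_mulVec_smul_lt hv (abs_le.2 ht))

theorem inv_mulVec_apex (δ : Fin 2 → ℝ) (σ : Fin 2 → ℤˣ) (i : Fin 2) :
    |(P⁻¹).1.mulVec (apex P δ σ) i| = |δ i| := by
  rw [apex, inv_mulVec_mulVec, abs_mul, abs_sgn, one_mul]

/-- The end tori `t = ±1` lie on the boundary; shrinking `t` to `s t` with `s < 1` enters the
annulus. Thus holomorphy near the closed annulus suffices for `T⁻¹`, without comparing `Γ` and `η`.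
-/
theorem slab_apex_subset_closure {δ : Fin 2 → ℝ} (hδ : ∀ i, 0 < δ i) (σ : Fin 2 → ℤˣ) :
    slab (apex P δ σ) ⊆ closure (annulus P δ) := by
  rintro z ⟨t, ht, hz⟩
  have hlim : Tendsto (fun s : ℝ => fun i => z i * Real.exp ((s - 1) * (t * apex P δ σ i)))
      (𝓝[<] 1) (𝓝 z) := by
    refine (Continuous.tendsto' (by fun_prop) 1 z ?_).mono_left nhdsWithin_le_nhds
    ext i; simp
  refine mem_closure_of_tendsto hlim ?_
  filter_upwards [Ioo_mem_nhdsLT (zero_lt_one (α := ℝ))] with s hs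
  refine mem_annulus_of_norm_eq (v := fun i => (s * t) * apex P δ σ i) (fun i => ?_) fun i => ?_
  · rw [norm_mul, hz, Complex.norm_real, Real.norm_eq_abs, Real.abs_exp, ← Real.exp_add]
    congr 1
    ring
  · have h : (fun i => (s * t) * apex P δ σ i) = (s * t) • apex P δ σ := rfl
    rw [h, Matrix.mulVec_smul, Pi.smul_apply, smul_eq_mul, abs_mul, inv_mulVec_apex]
    refine mul_lt_of_lt_one_left (abs_pos.2 (hδ i).ne') ?_
    rw [abs_mul, abs_of_pos hs.1]
    have := abs_le.2 ht
    nlinarith [hs.1, hs.2]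

/-- The pairing `n ⬝ v` equals `⟨Pᵀ n, P⁻¹ v⟩`, and the apex has `P⁻¹ v = (± δ₁, ± δ₂)`. The bound
holds for every `σ`, so it does not matter which source torus is used. -/
theorem abs_sum_mul_apex_le {δ : Fin 2 → ℝ} (hδ : ∀ i, 0 < δ i) (σ : Fin 2 → ℤˣ)
    (n : Fin 2 → ℤ) : |∑ i, (n i : ℝ) * apex P δ σ i| ≤ ∑ i, δ i * |dualVec P n i| := by
  rw [apex, sum_mul_mulVec]
  refine (Finset.abs_sum_le_sum_abs _ _).trans (Finset.sum_le_sum fun i _ => ?_)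
  rw [abs_mul, abs_mul, abs_sgn, one_mul, abs_of_pos (hδ i), mul_comm]

theorem expWeight_le_exp_apex {δ : Fin 2 → ℝ} (hδ : ∀ i, 0 < δ i) (σ : Fin 2 → ℤˣ)
    (n : Fin 2 → ℤ) : expWeight P δ n ≤ Real.exp (∑ i, n i * apex P δ σ i) :=
  Real.exp_le_exp.2 (abs_le.1 (abs_sum_mul_apex_le hδ σ n)).1

theorem exp_apex_le_expWeight_neg {δ : Fin 2 → ℝ} (hδ : ∀ i, 0 < δ i) (σ : Fin 2 → ℤˣ)
    (n : Fin 2 → ℤ) : Real.exp (∑ i, n i * apex P δ σ i) ≤ expWeight P (-δ) n := by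
  refine Real.exp_le_exp.2 ((abs_le.1 (abs_sum_mul_apex_le hδ σ n)).2.trans_eq ?_)
  simp

theorem expWeight_neg_le_exp_of_mem_cone {γ v : Fin 2 → ℝ} {σ : Fin 2 → ℤˣ} (hv : v ∈ cone P γ σ)
    {n : Fin 2 → ℤ} (hn : n ∈ quadrant P σ) :
    expWeight P (-γ) n ≤ Real.exp (∑ i, n i * v i) := by
  obtain ⟨y, hy, rfl⟩ := hv
  refine Real.exp_le_exp.2 ?_
  simp only [sum_mul_mulVec]
  rw [← Finset.sum_neg_distrib]
  refine Finset.sum_le_sum fun i _ => ?_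
  have h1 : dualVec P n i * y i = |dualVec P n i| * (sgn (σ i) * y i) := by
    conv_lhs => rw [hn i]
    ring
  rw [h1, Pi.neg_apply, neg_mul, neg_neg, mul_comm]
  exact mul_le_mul_of_nonneg_left (hy i).le (abs_nonneg _)

theorem coneWeight_eq (α β : Fin 2 → ℝ) (n : Fin 2 → ℤ) :
    (coneWeight P α β n : ℝ) =
      if 0 ≤ dualVec P n 0 * dualVec P n 1 then expWeight P α n else expWeight P β n := by
  split_ifs with h
  all_goals
    unfold dualVec at h
    simp only [coneWeight, expWeight, h, if_true, if_false, dualVec]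

theorem expWeight_pos (a : Fin 2 → ℝ) (n : Fin 2 → ℤ) : 0 < expWeight P a n := Real.exp_pos _

theorem sgn_one : sgn 1 = 1 := by simp [sgn]

theorem exists_mem_quadrant_of_nonneg {n : Fin 2 → ℤ}
    (h : 0 ≤ dualVec P n 0 * dualVec P n 1) : ∃ τ ∈ signs 1, n ∈ quadrant P τ := by
  rcases mul_nonneg_iff.1 h with ⟨h0, h1⟩ | ⟨h0, h1⟩
  · refine ⟨fun _ => 1, by simp [signs], Fin.forall_fin_two.2 ?_⟩
    simp [sgn_one, abs_of_nonneg h0, abs_of_nonneg h1]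
  · refine ⟨fun _ => -1, by simp [signs], Fin.forall_fin_two.2 ?_⟩
    simp [sgn_neg, sgn_one, abs_of_nonpos h0, abs_of_nonpos h1]

theorem exists_mem_quadrant_of_neg {n : Fin 2 → ℤ}
    (h : dualVec P n 0 * dualVec P n 1 < 0) : ∃ τ ∈ signs (-1), n ∈ quadrant P τ := by
  rcases mul_neg_iff.1 h with ⟨h0, h1⟩ | ⟨h0, h1⟩
  · refine ⟨![1, -1], by simp [signs], Fin.forall_fin_two.2 ?_⟩
    simp [sgn_neg, sgn_one, abs_of_pos h0, abs_of_neg h1]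
  · refine ⟨![-1, 1], by simp [signs], Fin.forall_fin_two.2 ?_⟩
    simp [sgn_neg, sgn_one, abs_of_neg h0, abs_of_pos h1]

/-- The matrix of the composition operator is bounded between the weighted `ℓ²` spaces. -/
theorem blockBound_compMatrix_coneWeight (T : (Fin 2 → Circle) ≃ (Fin 2 → Circle))
    (P : Matrix.GeneralLinearGroup (Fin 2) ℝ) {α γ A Γ η : Fin 2 → ℝ}
    (hα : ∀ i, 0 < α i) (hΓ : ∀ i, 0 < Γ i) (hη : ∀ i, 0 < η i) (hαη : ∀ i, α i < η i)
    {F G : (Fin 2 → ℂ) → (Fin 2 → ℂ)}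
    (hF : IsHolomorphicExtension T F (annulus P η)) (hG : ∀ z, G (toC2 z) = toC2 (T.symm z))
    (hT : StronglyExpanding 1 α A P F) (hTinv : StronglyExpanding (-1) Γ γ P G)
    (htorus : ∀ τ ∈ signs 1, ∀ σ ∈ signs (-1), ∃ ρ : Fin 2 → ℝ, (∀ i, 0 < ρ i) ∧
      polyTorus ρ ⊆ domain P γ σ ∩ annulus P η ∧ MapsTo F (polyTorus ρ) (domain P A τ)) :
    BlockBound (compMatrix T) (fun m => (coneWeight P A (-Γ) m : ℝ))
      (fun n => (coneWeight P α (-γ) n : ℝ)) univ univ := by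
  obtain ⟨hFd, hFT⟩ := hF
  have hU := isOpen_annulus (P := P) η
  have hone : slab (0 : Fin 2 → ℝ) ⊆ annulus P η :=
    slab_subset_annulus fun i => by simpa using (hη i).ne'
  obtain ⟨⟨V, hV, hVsub, hGV⟩, -⟩ := id hTinv
  set pos : Set (Fin 2 → ℤ) := {n | 0 ≤ dualVec P n 0 * dualVec P n 1} with hpos
  have hwpos : ∀ (a b : Fin 2 → ℝ), ∀ n ∈ pos, (coneWeight P a b n : ℝ) = expWeight P a n :=
    fun a b n hn => (coneWeight_eq a b n).trans (if_pos hn)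
  have hwneg : ∀ (a b : Fin 2 → ℝ), ∀ n ∈ posᶜ, (coneWeight P a b n : ℝ) = expWeight P b n :=
    fun a b n hn => (coneWeight_eq a b n).trans (if_neg hn)
  have hcpos : pos ⊆ ⋃ τ ∈ signs 1, pos ∩ quadrant P τ := fun n hn => by
    obtain ⟨τ, hτ, h⟩ := exists_mem_quadrant_of_nonneg hn
    exact mem_iUnion₂.2 ⟨τ, hτ, hn, h⟩
  have hcneg : posᶜ ⊆ ⋃ τ ∈ signs (-1), posᶜ ∩ quadrant P τ := fun n hn => by
    obtain ⟨τ, hτ, h⟩ := exists_mem_quadrant_of_neg (not_le.1 hn)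
    exact mem_iUnion₂.2 ⟨τ, hτ, hn, h⟩
  have habs : ∀ {x y : ℝ}, 0 < x → x ≤ y → |x| ≤ |y| := fun hx hxy => by
    rwa [abs_of_pos hx, abs_of_pos (hx.trans_le hxy)]
  -- Input `k₁ k₂ ≥ 0`, output `k₁ k₂ ≥ 0`: by (i), for exponents in the quadrant `τ` some torus of
  -- width `α` is sent to the domain with signs `-τ`.
  have hpp : BlockBound (compMatrix T) (fun m => (coneWeight P A (-Γ) m : ℝ))
      (fun n => (coneWeight P α (-γ) n : ℝ)) pos pos := by
    refine (BlockBound.biUnion_left (signs 1).toFinite (X := fun τ => pos ∩ quadrant P τ)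
      fun τ hτ => ?_).mono hcpos subset_rfl (fun _ _ => le_rfl) fun _ _ => le_rfl
    obtain ⟨σ, -, hmaps⟩ := hT.exists_mapsTo (neg_mem_signs hτ)
    have hv : slab (apex P α σ) ⊆ annulus P η := slab_subset_annulus fun i => by
      rw [inv_mulVec_apex, abs_of_pos (hα i), abs_of_pos (hη i)]
      exact hαη i
    refine (blockBound_compMatrix hU hv hFd hFT hmaps).mono
      (fun m hm => by rw [neg_neg]; exact hm.2) (subset_univ _) (fun m hm => ?_) fun n hn => ?_
    · rw [hwpos _ _ m hm.1]
    · rw [hwpos _ _ n hn]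
      exact habs (expWeight_pos _ _) (expWeight_le_exp_apex hα σ n)
  -- The output weight `exp ⟨γ, |k|⟩` grows; it is dominated on a torus inside the domain with signs
  -- `σ` and width `γ`, as supplied by (iii).
  have hpn : BlockBound (compMatrix T) (fun m => (coneWeight P A (-Γ) m : ℝ))
      (fun n => (coneWeight P α (-γ) n : ℝ)) pos posᶜ := by
    refine (BlockBound.biUnion_left (signs 1).toFinite (X := fun τ => pos ∩ quadrant P τ)
      fun τ hτ => ?_).mono hcpos subset_rfl (fun _ _ => le_rfl) fun _ _ => le_rfl
    refine (BlockBound.biUnion_right (signs (-1)).toFinite (Y := fun τ => posᶜ ∩ quadrant P τ)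
      fun σ hσ => ?_).mono subset_rfl hcneg (fun _ _ => le_rfl) fun _ _ => le_rfl
    obtain ⟨ρ, hρ, hρsub, hmaps⟩ := htorus _ (neg_mem_signs hτ) σ hσ
    have hρe : ρ = fun i => Real.exp (Real.log (ρ i)) :=
      funext fun i => (Real.exp_log (hρ i)).symm
    have hmem : (fun i => (ρ i : ℂ)) ∈ polyTorus ρ := fun i => by
      simpa using (hρ i).le
    have hlog : logAbs (fun i => (ρ i : ℂ)) = fun i => Real.log (ρ i) :=
      funext fun i => by simp [logAbs]
    have hv : slab (fun i => Real.log (ρ i)) ⊆ annulus P η := slab_subset_annulus fun i => by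
      rw [← hlog]
      exact (hρsub hmem).2.2 i
    have hcone : (fun i => Real.log (ρ i)) ∈ cone P γ σ := hlog ▸ (hρsub hmem).1.2
    rw [hρe] at hmaps
    refine (blockBound_compMatrix hU hv hFd hFT hmaps).mono
      (fun m hm => by rw [neg_neg]; exact hm.2) (subset_univ _) (fun m hm => ?_) fun n hn => ?_
    · rw [hwpos _ _ m hm.1]
    · rw [hwneg _ _ n hn.1]
      exact habs (expWeight_pos _ _) (expWeight_neg_le_exp_of_mem_cone hcone hn.2)
  -- The input weight grows and the output weight is at most `1`, so the unit torus is enough: with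
  -- the negative parameter `-Γ` the cone contains `0`.
  have hnp : BlockBound (compMatrix T) (fun m => (coneWeight P A (-Γ) m : ℝ))
      (fun n => (coneWeight P α (-γ) n : ℝ)) posᶜ pos := by
    refine (BlockBound.biUnion_left (signs (-1)).toFinite (X := fun τ => posᶜ ∩ quadrant P τ)
      fun τ _ => ?_).mono hcneg subset_rfl (fun _ _ => le_rfl) fun _ _ => le_rfl
    have hmaps : MapsTo F (polyTorus fun i => Real.exp ((0 : Fin 2 → ℝ) i))
        (domain P (-Γ) (-τ)) := by
      intro z hz
      obtain ⟨θ, rfl⟩ := exists_spread_eq (v := 0) (t := 0) (z := z) fun i => by simpa using hz i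
      rw [Complex.ofReal_zero, spread_zero, hFT]
      have hn : ∀ i, ‖toC2 (T fun i => (θ i).toCircle) i‖ = 1 := fun i => Circle.norm_coe _
      refine ⟨fun i => norm_ne_zero_iff.1 (by rw [hn]; exact one_ne_zero), 0, fun i => ?_, ?_⟩
      · simpa using hΓ i
      · ext i
        simp [logAbs, hn]
    refine (blockBound_compMatrix hU hone hFd hFT hmaps).mono
      (fun m hm => by rw [neg_neg]; exact hm.2) (subset_univ _) (fun m hm => ?_) fun n hn => ?_
    · rw [hwneg _ _ m hm.1]
    · rw [hwpos _ _ n hn]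
      refine habs (expWeight_pos _ _) (Real.exp_le_exp.2 ?_)
      have : 0 ≤ ∑ i, α i * |dualVec P n i| :=
        Finset.sum_nonneg fun i _ => mul_nonneg (hα i).le (abs_nonneg _)
      simp only [Pi.zero_apply, mul_zero, Finset.sum_const_zero]
      exact neg_nonpos.2 this
  -- Both weights grow; dualising makes them decay, and (ii) plays for `T⁻¹` the role of (i).
  have hnn : BlockBound (compMatrix T) (fun m => (coneWeight P A (-Γ) m : ℝ))
      (fun n => (coneWeight P α (-γ) n : ℝ)) posᶜ posᶜ := by
    refine (BlockBound.biUnion_right (signs (-1)).toFinite (Y := fun τ => posᶜ ∩ quadrant P τ)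
      fun τ hτ => ?_).mono subset_rfl hcneg (fun _ _ => le_rfl) fun _ _ => le_rfl
    obtain ⟨σ, -, hmaps⟩ := hTinv.exists_mapsTo hτ
    have hv : slab (apex P Γ σ) ⊆ V := (slab_apex_subset_closure hΓ σ).trans hVsub
    refine (blockBound_compMatrix_of_inverse T hU hV hFd hGV
      (fun z => hone (toC2_mem_slab 0 z)) hFT hG hv hmaps).mono
      (subset_univ _) (fun n hn => hn.2) (fun m hm => ?_) fun n hn => ?_
    · rw [hwneg _ _ m hm]
      exact habs (Real.exp_pos _) (exp_apex_le_expWeight_neg hΓ σ m)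
    · rw [hwneg _ _ n hn.1]
  have h := (hpp.union_right hpn).union_left (hnp.union_right hnn)
  rwa [union_compl_self] at h

end Geometry

/-! ### From bounded matrices to operators on the completions -/

section Hardy

variable {ν : (Fin 2 → ℤ) → {x : ℝ // 0 < x}}

theorem Laurent.norm_sq_eq (f : Laurent ν) :
    ‖f‖ ^ 2 = ∑ n ∈ f.finite_support.toFinset, ‖f.coeff n‖ ^ 2 * (ν n : ℝ) ^ 2 := by
  have h1 : inner ℂ f f = ((‖f‖ : ℂ)) ^ 2 := inner_self_eq_norm_sq_to_K (𝕜 := ℂ) f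
  have h2 : inner ℂ f f = weightedInner ν f f := rfl
  rw [h2, weightedInner_self] at h1
  exact_mod_cast h1.symm

theorem coeff_monomial (m n : Fin 2 → ℤ) : (monomial ν m).coeff n = if m = n then 1 else 0 := by
  classical
  exact Finsupp.single_apply

/-- The normalised monomials are orthonormal in `H_ν`. -/
theorem orthonormal_monomial : Orthonormal ℂ fun n : Fin 2 → ℤ =>
    ((ν n : ℝ)⁻¹ : ℂ) • ((monomial ν n : Laurent ν) : HardySpace ν) := by
  classical
  rw [orthonormal_iff_ite]
  intro m n
  rw [inner_smul_left, inner_smul_right, UniformSpace.Completion.inner_coe]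
  have h1 : inner ℂ (monomial ν m) (monomial ν n) = weightedInner ν (monomial ν m) (monomial ν n) :=
    rfl
  have h2 : Function.support (monomial ν m).coeff ⊆ (({m} : Finset (Fin 2 → ℤ)) : Set _) := by
    intro k hk
    by_contra hkm
    refine hk ?_
    rw [coeff_monomial, if_neg]
    rintro rfl
    simp at hkm
  rw [h1, weightedInner_eq_sum ν _ _ {m} h2, Finset.sum_singleton, coeff_monomial, coeff_monomial,
    if_pos rfl]
  have hν : ((ν m : ℝ) : ℂ) ≠ 0 := by exact_mod_cast (ν m).2.ne'
  by_cases h : m = n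
  · subst h
    simp only [if_true, map_one, one_mul, map_inv₀, Complex.conj_ofReal]
    push_cast
    field_simp
  · simp [h, Ne.symm h]

/-- Riesz-Fischer: relative to the normalised monomials the coefficients are `g n * ν n`, so bounded
partial sums of squares force convergence. -/
theorem exists_hasSum_monomial {g : (Fin 2 → ℤ) → ℂ} {B : ℝ}
    (hg : ∀ S : Finset (Fin 2 → ℤ), ∑ n ∈ S, ‖g n‖ ^ 2 * (ν n : ℝ) ^ 2 ≤ B) :
    ∃ h : HardySpace ν, HasSum (fun n => g n • ((monomial ν n : Laurent ν) : HardySpace ν)) h ∧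
      ‖h‖ ^ 2 ≤ B := by
  have hO := (orthonormal_monomial (ν := ν)).orthogonalFamily
  have hterm : ∀ n, LinearIsometry.toSpanSingleton ℂ (HardySpace ν)
      ((orthonormal_monomial (ν := ν)).1 n) (g n * (ν n : ℝ)) =
      g n • ((monomial ν n : Laurent ν) : HardySpace ν) := by
    intro n
    have hν : ((ν n : ℝ) : ℂ) ≠ 0 := by exact_mod_cast (ν n).2.ne'
    rw [LinearIsometry.toSpanSingleton_apply, smul_smul]
    congr 1
    field_simp
  have hnorm : ∀ n, ‖g n * ((ν n : ℝ) : ℂ)‖ ^ 2 = ‖g n‖ ^ 2 * (ν n : ℝ) ^ 2 := fun n => by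
    rw [norm_mul, mul_pow, Complex.norm_real, Real.norm_eq_abs, sq_abs]
  have hs := (hO.summable_iff_norm_sq_summable fun n => g n * ((ν n : ℝ) : ℂ)).2 (by
    simp only [hnorm]
    exact summable_of_sum_le (fun n => by positivity) hg)
  simp only [hterm] at hs
  obtain ⟨h, hh⟩ := hs
  refine ⟨h, hh, ?_⟩
  refine le_of_tendsto ((continuous_norm.pow 2).tendsto h |>.comp hh)
    (Eventually.of_forall fun S => ?_)
  have h1 := hO.norm_sum (fun n => g n * ((ν n : ℝ) : ℂ)) S
  simp only [hterm, hnorm] at h1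
  exact h1.trans_le (hg S)

theorem Laurent.toFun_eq_sum (f : Laurent ν) (z : Fin 2 → Circle) :
    f.toFun z = ∑ n ∈ f.finite_support.toFinset, f.coeff n * ∏ i, (z i : ℂ) ^ n i := by
  refine finsum_eq_sum_of_support_subset _ fun n hn => ?_
  simp only [Finite.coe_toFinset, Function.mem_support] at hn ⊢
  exact left_ne_zero_of_mul hn

theorem Represents.unique {g : (Fin 2 → Circle) → ℂ} {h₁ h₂ : HardySpace ν}
    (H₁ : Represents g h₁) (H₂ : Represents g h₂) : h₁ = h₂ := HasSum.unique H₁ H₂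

end Hardy

theorem continuous_prod_zpow {T : (Fin 2 → Circle) → (Fin 2 → Circle)} (hT : Continuous T)
    (m : Fin 2 → ℤ) : Continuous fun z => ∏ i, (T z i : ℂ) ^ m i := by
  refine continuous_finsetProd _ fun i _ => ?_
  refine Continuous.zpow₀ ?_ _ fun z => Or.inl (Circle.coe_ne_zero _)
  exact continuous_subtype_val.comp ((continuous_apply i).comp hT)

/-- A bounded matrix defines the composition operator. -/
theorem existsUnique_composition_operator {ν ω : (Fin 2 → ℤ) → {x : ℝ // 0 < x}}
    {T : (Fin 2 → Circle) → (Fin 2 → Circle)} (hT : Continuous T)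
    (h : BlockBound (compMatrix T) (fun m => (ν m : ℝ)) (fun n => (ω n : ℝ)) univ univ) :
    ∃! L : HardySpace ν →L[ℂ] HardySpace ω, ∀ f : Laurent ν,
      Represents (fun z => f.toFun (T z)) (L (f : HardySpace ν)) := by
  obtain ⟨C, hC, h⟩ := h
  have hcoef : ∀ (f : Laurent ν) n, fourierCoefficient (fun z => f.toFun (T z)) n =
      ∑ m ∈ f.finite_support.toFinset, f.coeff m * compMatrix T m n := by
    intro f n
    simp only [Laurent.toFun_eq_sum]
    exact fourierCoefficient_sum _ _ (fun m _ => continuous_prod_zpow hT m) n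
  -- Written over all of `Finsupp`, the coefficient is visibly linear in `f`; the sum over the
  -- support in `hcoef` hides this.
  have hcoef' : ∀ (f : Laurent ν) n, fourierCoefficient (fun z => f.toFun (T z)) n =
      Finsupp.linearCombination ℂ (fun m => compMatrix T m n)
        (show (Fin 2 → ℤ) →₀ ℂ from f) := by
    intro f n
    rw [hcoef, Finsupp.linearCombination_apply, Finsupp.sum]
    refine Finset.sum_congr ?_ fun _ _ => rfl
    ext m
    rw [Finite.mem_toFinset]
    exact Finsupp.mem_support_iff.symm
  have hex : ∀ f : Laurent ν, ∃ H : HardySpace ω, Represents (fun z => f.toFun (T z)) H ∧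
      ‖H‖ ^ 2 ≤ C * ‖f‖ ^ 2 := by
    intro f
    refine exists_hasSum_monomial fun S => ?_
    rw [Laurent.norm_sq_eq]
    simp only [hcoef]
    exact h _ _ S (subset_univ _) (subset_univ _)
  choose L₀ hL₀ hbound using hex
  let L₁ : Laurent ν →ₗ[ℂ] HardySpace ω :=
    { toFun := L₀
      map_add' := fun f g => by
        refine (hL₀ (f + g)).unique ?_
        have h1 := HasSum.add (hL₀ f) (hL₀ g)
        refine HasSum.congr_fun h1 fun n => ?_
        rw [← add_smul, hcoef', hcoef', hcoef', ← map_add]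
        rfl
      map_smul' := fun a f => by
        refine (hL₀ (a • f)).unique ?_
        have h1 := HasSum.const_smul a (hL₀ f)
        refine HasSum.congr_fun h1 fun n => ?_
        rw [smul_smul, hcoef', hcoef', ← smul_eq_mul, ← map_smul]
        rfl }
  let L₂ : Laurent ν →L[ℂ] HardySpace ω := L₁.mkContinuous (Real.sqrt C) fun f => by
    refine abs_le_of_sq_le_sq' ?_ (by positivity) |>.2
    rw [mul_pow, Real.sq_sqrt hC]
    exact hbound f
  have hdense : DenseRange (UniformSpace.Completion.toComplL (𝕜 := ℂ) (E := Laurent ν)) :=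
    UniformSpace.Completion.denseRange_coe
  refine ⟨L₂.extend UniformSpace.Completion.toComplL, fun f => ?_, fun L hL => ?_⟩
  · have h1 := L₂.extend_eq hdense (UniformSpace.Completion.isUniformInducing_coe _) f
    have h2 : L₂.extend UniformSpace.Completion.toComplL (f : HardySpace ν) = L₀ f := h1
    rw [h2]
    exact hL₀ f
  · refine (L₂.extend_unique hdense (UniformSpace.Completion.isUniformInducing_coe _) L ?_).symm
    ext f
    exact (hL f).unique (hL₀ f)

theorem continuous_of_isHolomorphicExtension {T : (Fin 2 → Circle) → (Fin 2 → Circle)}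
    {F : (Fin 2 → ℂ) → (Fin 2 → ℂ)} {U : Set (Fin 2 → ℂ)} (hF : IsHolomorphicExtension T F U)
    (hU : ∀ z, toC2 z ∈ U) : Continuous T := by
  have h : Continuous fun z => F (toC2 z) :=
    hF.1.continuousOn.comp_continuous continuous_toC2 hU
  simp only [hF.2] at h
  refine continuous_pi fun i => Topology.IsEmbedding.subtypeVal.continuous_iff.2 ?_
  exact (continuous_apply i).comp h

end TorusHardy

end

open TorusHardy in
/-- The diffeomorphism of the unit torus is the bijection `T`; it and its inverse are analytic
because they have the holomorphic extensions `F` and `G`. -/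
theorem theorem3
    (T : (Fin 2 → Circle) ≃ (Fin 2 → Circle))
    (P : Matrix.GeneralLinearGroup (Fin 2) ℝ)
    (α γ A Γ η : Fin 2 → ℝ)
    (hα : ∀ i, 0 < α i) (hγ : ∀ i, 0 < γ i) (hA : ∀ i, 0 < A i) (hΓ : ∀ i, 0 < Γ i)
    (hη : ∀ i, 0 < η i) (hαη : ∀ i, α i < η i) (hγη : ∀ i, γ i < η i)
    (F G : (Fin 2 → ℂ) → (Fin 2 → ℂ))
    (hF : IsHolomorphicExtension T F (annulus P η))
    (hG : IsHolomorphicExtension T.symm G (annulus P η))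
    (hT : StronglyExpanding 1 α A P F)
    (hTinv : StronglyExpanding (-1) Γ γ P G)
    (htorus : ∀ τ ∈ signs 1, ∀ σ ∈ signs (-1), ∃ ρ : Fin 2 → ℝ, (∀ i, 0 < ρ i) ∧
      polyTorus ρ ⊆ domain P γ σ ∩ annulus P η ∧ Set.MapsTo F (polyTorus ρ) (domain P A τ)) :
    ∃! L : HardySpace (coneWeight P A (-Γ)) →L[ℂ] HardySpace (coneWeight P α (-γ)),
      ∀ f : Laurent (coneWeight P A (-Γ)),
        Represents (fun z => f.toFun (T z)) (L (f : HardySpace (coneWeight P A (-Γ)))) := by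
  have hT0 : Continuous T := continuous_of_isHolomorphicExtension hF fun z =>
    slab_subset_annulus (v := 0) (fun i => by simpa using (hη i).ne') (toC2_mem_slab 0 z)
  exact existsUnique_composition_operator hT0
    (blockBound_compMatrix_coneWeight T P hα hΓ hη hαη hF hG.2 hT hTinv htorus)
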